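/- Let $K$ be an algebraically closed field, $A$ a (not necessarily commutative) $K$-algebra that is a domain, and $\alpha$ a $K$-algebra automorphism of $A$ with inverse $\beta$. Let $u$ be a central element of $A$ with $u\notin K$, and suppose that $v=u-\alpha(u)$. Let $R=R(A,\alpha,v,1)$ be the ambiskew polynomial ring $A[y;\alpha][x;\beta,\delta]$, where $\beta(y)=y$, $\delta(A)=0$ and $\delta(y)=v$; thus $ya=\alpha(a)y$ and $xa=\beta(a)x$ for all $a\in A$, and $xy=yx+v$. Let $z=xy-u$ be its Casimir element. For $m\ge 1$ put $v^{(m)}=\sum_{l=0}^{m-1}\alpha^l(v)$. Suppose that 1. the skew Laurent polynomial ring $A[y^{\pm1};\alpha]$ is simple; 2. the centre of $A[y^{\pm1};\alpha]$ is $K$; 3. for every $m\ge 1$ there is a non-zero polynomial $p_m(X)\in K[X]$ such that $p_m(u)\in v^{(m)}A$. Then the height one prime ideals of $R$ are exactly the sets $(z-\lambda)R$ with $\lambda\in K$; in particular each of these sets is a two-sided ideal. Consequently $R$ is a noncommutative unique factorisation domain in the sense of Chatters: $R$ is a domain, $R$ has at least one height one prime ideal, and every height one prime ideal $P$ of $R$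 is of the form $P=pR=Rp$ for some non-zero $p\in R$, with $R/P$ a domain. (Chatters states the notion for Noetherian domains; no Noetherian condition is assumed or asserted here, and when $R$ is left and right Noetherian this is exactly his notion.) Here a proper two-sided ideal $P$ is prime if $aRb\subseteq P$ implies $a\in P$ or $b\in P$, and its height is the supremum of the lengths $n$ of chains $P_0\subsetneq P_1\subsetneq\dots\subsetneq P_n=P$ of prime ideals. -/

import Mathlib

/-- A (left) `σ`-derivation of a ring `B`: an additive map `δ` with
`δ (a b) = σ(a) δ(b) + δ(a) b`. -/
structure SkewDerivation {B : Type*} [Ring B] (σ : B →+* B) where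
  /-- the underlying additive map -/
  toAddHom : B →+ B
  leibniz : ∀ a b : B, toAddHom (a * b) = σ a * toAddHom b + toAddHom a * b

/-- The zero `σ`-derivation. -/
def SkewDerivation.zero {B : Type*} [Ring B] (σ : B →+* B) : SkewDerivation σ where
  toAddHom := 0
  leibniz := by intro a b; simp

/-- The skew polynomial ring (Ore extension) `B[x; σ, δ]`.  Its elements are the finite sums
`∑ bᵢ xⁱ` with coefficients on the left, stored as finitely supported functions `i ↦ bᵢ`;
the multiplication (defined below) is determined by `x b = σ(b) x + δ(b)`. -/
def OreExtension {B : Type*} [Ring B] (σ : B →+* B) (_δ : SkewDerivation σ) : Type _ :=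
  ℕ →₀ B

namespace OreExtension

variable {B : Type*} [Ring B] (σ : B →+* B) (δ : SkewDerivation σ)

noncomputable instance instAddCommGroup : AddCommGroup (OreExtension σ δ) :=
  inferInstanceAs (AddCommGroup (ℕ →₀ B))

/-- Left multiplication by the variable: `∑ bᵢ xⁱ ↦ ∑ (σ(bᵢ) xⁱ⁺¹ + δ(bᵢ) xⁱ)`. -/
noncomputable def varMul : (ℕ →₀ B) →+ (ℕ →₀ B) :=
  Finsupp.liftAddHom fun i =>
    (Finsupp.singleAddHom (i + 1)).comp σ.toAddMonoidHom +
      (Finsupp.singleAddHom i).comp δ.toAddHom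

/-- The product of `p = ∑ bᵢ xⁱ` and `q`: the sum of the `bᵢ • (x · (x ⋯ (x · q)))`, where left
multiplication by `x` is iterated `i` times. -/
noncomputable def mul (p q : ℕ →₀ B) : ℕ →₀ B :=
  p.sum fun i b => b • (varMul σ δ)^[i] q

theorem varMul_single (i : ℕ) (b : B) :
    varMul σ δ (Finsupp.single i b) =
      Finsupp.single (i + 1) (σ b) + Finsupp.single i (δ.toAddHom b) :=
  Finsupp.liftAddHom_apply_single _ _ _

theorem mul_single (i : ℕ) (b : B) (q : ℕ →₀ B) :
    mul σ δ (Finsupp.single i b) q = b • (varMul σ δ)^[i] q :=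
  Finsupp.sum_single_index (zero_smul B _)

theorem add_mul' (p p' q : ℕ →₀ B) : mul σ δ (p + p') q = mul σ δ p q + mul σ δ p' q :=
  Finsupp.sum_add_index' (fun _ => zero_smul B _) fun _ b c => add_smul b c _

theorem mul_add' (p q q' : ℕ →₀ B) : mul σ δ p (q + q') = mul σ δ p q + mul σ δ p q' := by
  simp only [mul, iterate_map_add, smul_add, Finsupp.sum_add]

theorem zero_mul' (q : ℕ →₀ B) : mul σ δ 0 q = 0 :=
  Finsupp.sum_zero_index

theorem mul_zero' (p : ℕ →₀ B) : mul σ δ p 0 = 0 := by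
  simp [mul, iterate_map_zero]

theorem varMul_smul (b : B) (q : ℕ →₀ B) :
    varMul σ δ (b • q) = σ b • varMul σ δ q + δ.toAddHom b • q := by
  induction q using Finsupp.induction_linear with
  | zero => simp
  | add p q hp hq => rw [smul_add, map_add, hp, hq, map_add, smul_add, smul_add]; abel
  | single i c =>
    rw [Finsupp.smul_single, varMul_single, varMul_single, smul_eq_mul, map_mul, δ.leibniz,
      smul_add, Finsupp.smul_single, Finsupp.smul_single, Finsupp.smul_single,
      Finsupp.single_add, smul_eq_mul, smul_eq_mul, smul_eq_mul, add_assoc]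

theorem smul_mul' (b : B) (p q : ℕ →₀ B) : mul σ δ (b • p) q = b • mul σ δ p q := by
  induction p using Finsupp.induction_linear with
  | zero => simp [zero_mul']
  | add p p' hp hp' => rw [smul_add, add_mul', hp, hp', add_mul', smul_add]
  | single i c => rw [Finsupp.smul_single, mul_single, mul_single, smul_eq_mul, mul_smul]

theorem varMul_mul (p q : ℕ →₀ B) : mul σ δ (varMul σ δ p) q = varMul σ δ (mul σ δ p q) := by
  induction p using Finsupp.induction_linear with
  | zero => simp [zero_mul']
  | add p p' hp hp' => rw [map_add, add_mul', hp, hp', add_mul', map_add]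
  | single i c =>
    rw [varMul_single, add_mul', mul_single, mul_single, mul_single, varMul_smul,
      Function.iterate_succ_apply']

theorem mul_assoc' (p q r : ℕ →₀ B) : mul σ δ (mul σ δ p q) r = mul σ δ p (mul σ δ q r) := by
  induction p using Finsupp.induction_linear with
  | zero => simp [zero_mul']
  | add p p' hp hp' => rw [add_mul', add_mul', hp, hp', add_mul']
  | single i c =>
    have key : ∀ i : ℕ, mul σ δ ((varMul σ δ)^[i] q) r = (varMul σ δ)^[i] (mul σ δ q r) := by
      intro i
      induction i with
      | zero => rfl
      | succ i ih =>
        rw [Function.iterate_succ_apply', Function.iterate_succ_apply', varMul_mul, ih]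
    rw [mul_single, mul_single, smul_mul', key]

theorem one_mul' (q : ℕ →₀ B) : mul σ δ (Finsupp.single 0 1) q = q := by
  rw [mul_single, Function.iterate_zero_apply, one_smul]

theorem varMul_iterate_one (i : ℕ) :
    (varMul σ δ)^[i] (Finsupp.single 0 1) = Finsupp.single i 1 := by
  induction i with
  | zero => rfl
  | succ i ih =>
    have h1 : δ.toAddHom 1 = 0 := by
      have h := δ.leibniz 1 1
      simpa using h
    rw [Function.iterate_succ_apply', ih, varMul_single, h1, map_one, Finsupp.single_zero,
      add_zero]

theorem mul_one' (p : ℕ →₀ B) : mul σ δ p (Finsupp.single 0 1) = p := by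
  induction p using Finsupp.induction_linear with
  | zero => exact zero_mul' σ δ _
  | add p q hp hq => rw [add_mul', hp, hq]
  | single i c => rw [mul_single, varMul_iterate_one, Finsupp.smul_single, smul_eq_mul, mul_one]

noncomputable instance instRing : Ring (OreExtension σ δ) where
  __ := instAddCommGroup σ δ
  mul := mul σ δ
  one := (Finsupp.single 0 1 : ℕ →₀ B)
  left_distrib := mul_add' σ δ
  right_distrib := add_mul' σ δ
  zero_mul := zero_mul' σ δ
  mul_zero := mul_zero' σ δ
  mul_assoc := mul_assoc' σ δ
  one_mul := one_mul' σ δ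
  mul_one := mul_one' σ δ

/-- The monomial `b xⁱ`. -/
noncomputable def monomial (i : ℕ) (b : B) : OreExtension σ δ :=
  (Finsupp.single i b : ℕ →₀ B)

/-- The inclusion of the coefficient ring `B → B[x; σ, δ]`. -/
noncomputable def C : B →+* OreExtension σ δ where
  toFun b := monomial σ δ 0 b
  map_zero' := Finsupp.single_zero 0
  map_add' := Finsupp.single_add 0
  map_one' := rfl
  map_mul' a b := by
    have h : mul σ δ (Finsupp.single 0 a) (Finsupp.single 0 b) = Finsupp.single 0 (a * b) := by
      rw [mul_single, Function.iterate_zero_apply, Finsupp.smul_single, smul_eq_mul]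
    exact h.symm

/-- The variable `x` of `B[x; σ, δ]`. -/
noncomputable def X : OreExtension σ δ := monomial σ δ 1 1

end OreExtension

section Ambiskew

variable {K A : Type*} [Field K] [Ring A] [Algebra K A]

/-- The skew polynomial ring `A[y; α]`, where `y a = α(a) y`. -/
abbrev SkewPolyRing (α : A ≃ₐ[K] A) : Type _ :=
  OreExtension (α : A →+* A) (SkewDerivation.zero _)

theorem SkewPolyRing.varMul_iterate_single (α : A ≃ₐ[K] A) (m n : ℕ) (b : A) :
    (OreExtension.varMul (α : A →+* A) (SkewDerivation.zero _))^[m] (Finsupp.single n b) =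
      Finsupp.single (m + n) ((α ^ m) b) := by
  induction m with
  | zero => simp
  | succ m ih =>
    rw [Function.iterate_succ_apply', ih, OreExtension.varMul_single, pow_succ',
      AlgEquiv.mul_apply, add_right_comm]
    simp [SkewDerivation.zero]

theorem SkewPolyRing.monomial_mul_monomial (α : A ≃ₐ[K] A) (m n : ℕ) (a b : A) :
    (OreExtension.monomial _ _ m a * OreExtension.monomial _ _ n b : SkewPolyRing α) =
      OreExtension.monomial _ _ (m + n) (a * (α ^ m) b) := by
  have h : OreExtension.mul (α : A →+* A) (SkewDerivation.zero _) (Finsupp.single m a)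
      (Finsupp.single n b) = Finsupp.single (m + n) (a * (α ^ m) b) := by
    rw [OreExtension.mul_single, varMul_iterate_single, Finsupp.smul_single, smul_eq_mul]
  exact h

theorem SkewPolyRing.induction_on {α : A ≃ₐ[K] A} {p : SkewPolyRing α → Prop}
    (f : SkewPolyRing α) (h0 : p 0) (hadd : ∀ f g, p f → p g → p (f + g))
    (hm : ∀ m a, p (OreExtension.monomial _ _ m a)) : p f :=
  Finsupp.induction_linear (motive := p) f h0 hadd hm

/-- The extension of `β = α⁻¹` to `A[y; α]` with `β(y) = y`:  `∑ aᵢ yⁱ ↦ ∑ β(aᵢ) yⁱ`. -/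
noncomputable def SkewPolyRing.betaAddHom (α : A ≃ₐ[K] A) : SkewPolyRing α →+ SkewPolyRing α :=
  (Finsupp.mapRange.addMonoidHom (ι := ℕ) (α.symm : A →+ A) : (ℕ →₀ A) →+ (ℕ →₀ A))

theorem SkewPolyRing.betaAddHom_monomial (α : A ≃ₐ[K] A) (m : ℕ) (a : A) :
    betaAddHom α (OreExtension.monomial _ _ m a) = OreExtension.monomial _ _ m (α.symm a) :=
  Finsupp.mapRange_single (hf := map_zero α.symm)

theorem SkewPolyRing.symm_pow_comm (α : A ≃ₐ[K] A) (m : ℕ) (a : A) :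
    α.symm ((α ^ m) a) = (α ^ m) (α.symm a) := by
  change (α⁻¹ * α ^ m) a = (α ^ m * α⁻¹) a
  group

/-- The extension of `β = α⁻¹` to `A[y; α]` with `β(y) = y`, as a ring homomorphism. -/
noncomputable def SkewPolyRing.beta (α : A ≃ₐ[K] A) : SkewPolyRing α →+* SkewPolyRing α where
  toFun := betaAddHom α
  map_zero' := map_zero _
  map_add' := map_add _
  map_one' := by
    change betaAddHom α (OreExtension.monomial _ _ 0 1) = OreExtension.monomial _ _ 0 1
    rw [betaAddHom_monomial, map_one]
  map_mul' f g := by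
    change betaAddHom α (f * g) = betaAddHom α f * betaAddHom α g
    induction f using SkewPolyRing.induction_on with
    | h0 => simp only [zero_mul, map_zero]
    | hadd f f' h h' => rw [add_mul, map_add, h, h', map_add, add_mul]
    | hm m a => ?_
    induction g using SkewPolyRing.induction_on with
    | h0 => simp only [mul_zero, map_zero]
    | hadd g g' h h' => rw [mul_add, map_add, h, h', map_add, mul_add]
    | hm n b => ?_
    rw [monomial_mul_monomial, betaAddHom_monomial, betaAddHom_monomial, betaAddHom_monomial,
      monomial_mul_monomial, map_mul, symm_pow_comm]

/-- `v⁽ᵐ⁾ = ∑_{l < m} αˡ(v)`; in particular `v⁽⁰⁾ = 0` and `v⁽¹⁾ = v`. -/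
def iterV (α : A ≃ₐ[K] A) (v : A) (m : ℕ) : A :=
  ∑ l ∈ Finset.range m, (α ^ l) v

theorem iterV_add (α : A ≃ₐ[K] A) (v : A) (m n : ℕ) :
    iterV α v (m + n) = iterV α v m + (α ^ m) (iterV α v n) := by
  simp only [iterV, Finset.sum_range_add, map_sum, pow_add, AlgEquiv.mul_apply]

theorem iterV_comm (α : A ≃ₐ[K] A) (v : Subring.center A) (m : ℕ) (a : A) :
    iterV α v m * a = a * iterV α v m := by
  have hl : ∀ l : ℕ, (α ^ l) (v : A) * a = a * (α ^ l) (v : A) := by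
    intro l
    have h := Subring.mem_center_iff.1 v.2 ((α ^ l).symm a)
    have h2 := congrArg (α ^ l) h
    rw [map_mul, map_mul, AlgEquiv.apply_symm_apply] at h2
    exact h2.symm
  simp only [iterV, Finset.sum_mul, Finset.mul_sum, hl]

/-- The additive map of `A[y; α]` with `a yᵐ ↦ β(a) v⁽ᵐ⁾ yᵐ⁻¹` (and `a ↦ 0` for `m = 0`). -/
noncomputable def SkewPolyRing.deltaAddHom (α : A ≃ₐ[K] A) (v : A) :
    SkewPolyRing α →+ SkewPolyRing α :=
  (Finsupp.liftAddHom fun m =>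
    (Finsupp.singleAddHom (m - 1)).comp
      ((AddMonoidHom.mulRight (iterV α v m)).comp (α.symm : A →+ A)) :
        (ℕ →₀ A) →+ (ℕ →₀ A))

theorem SkewPolyRing.deltaAddHom_monomial (α : A ≃ₐ[K] A) (v : A) (m : ℕ) (a : A) :
    deltaAddHom α v (OreExtension.monomial _ _ m a) =
      OreExtension.monomial _ _ (m - 1) (α.symm a * iterV α v m) := by
  refine (Finsupp.liftAddHom_apply_single _ _ _).trans ?_
  rfl

theorem SkewPolyRing.monomial_add (α : A ≃ₐ[K] A) (m : ℕ) (a b : A) :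
    (OreExtension.monomial _ _ m (a + b) : SkewPolyRing α) =
      OreExtension.monomial _ _ m a + OreExtension.monomial _ _ m b :=
  Finsupp.single_add m a b

theorem SkewPolyRing.monomial_zero (α : A ≃ₐ[K] A) (m : ℕ) :
    (OreExtension.monomial _ _ m 0 : SkewPolyRing α) = 0 :=
  Finsupp.single_zero m

/-- The `β`-derivation `δ` of `A[y; α]` with `δ(A) = 0` and `δ(y) = v`, for central `v`. -/
noncomputable def SkewPolyRing.delta (α : A ≃ₐ[K] A) (v : Subring.center A) :
    SkewDerivation (SkewPolyRing.beta α) where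
  toAddHom := deltaAddHom α v
  leibniz f g := by
    change deltaAddHom α v (f * g) =
      betaAddHom α f * deltaAddHom α v g + deltaAddHom α v f * g
    induction f using SkewPolyRing.induction_on with
    | h0 => simp only [zero_mul, map_zero, add_zero]
    | hadd f f' h h' =>
      rw [add_mul, map_add, h, h', map_add, map_add, add_mul, add_mul]
      abel
    | hm m a => ?_
    induction g using SkewPolyRing.induction_on with
    | h0 => simp only [mul_zero, map_zero, add_zero]
    | hadd g g' h h' =>
      rw [mul_add, map_add, h, h', map_add, mul_add, mul_add]
      abel
    | hm n b => ?_
    have h0 : iterV α (v : A) 0 = 0 := by simp [iterV]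
    rw [monomial_mul_monomial, deltaAddHom_monomial, betaAddHom_monomial, deltaAddHom_monomial,
      deltaAddHom_monomial, monomial_mul_monomial, monomial_mul_monomial, map_mul, symm_pow_comm,
      map_mul]
    rcases m with _ | m
    · simp [h0, monomial_zero, mul_assoc]
    have e1 : (α ^ (m + 1)) (α.symm b) = (α ^ m) b := by
      change (α ^ (m + 1) * α⁻¹) b = (α ^ m) b
      rw [pow_succ, mul_assoc, mul_inv_cancel, mul_one]
    rcases n with _ | n
    · rw [h0, map_zero, mul_zero, mul_zero, monomial_zero, zero_add, e1]
      simp only [Nat.add_sub_cancel, Nat.add_zero]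
      rw [mul_assoc, mul_assoc, iterV_comm]
    · rw [iterV_add, mul_add, e1]
      have i1 : m + 1 + (n + 1) - 1 = m + 1 + n := by omega
      have i2 : m + 1 - 1 + (n + 1) = m + 1 + n := by omega
      have i3 : m + 1 + (n + 1 - 1) = m + 1 + n := by omega
      rw [i1, i2, i3, monomial_add, add_comm]
      congr 2
      · simp only [mul_assoc]
      · simp only [Nat.add_sub_cancel, mul_assoc]
        rw [iterV_comm]

/-- The ambiskew polynomial ring `R(A, α, v, 1) = A[y; α][x; β, δ]`, where `β = α⁻¹` on `A`,
`β(y) = y`, `δ(A) = 0` and `δ(y) = v`.  Thus `y a = α(a) y`, `x a = β(a) x` and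
`x y = y x + v`. -/
abbrev AmbiskewRing (α : A ≃ₐ[K] A) (v : Subring.center A) : Type _ :=
  OreExtension (SkewPolyRing.beta α) (SkewPolyRing.delta α v)

namespace AmbiskewRing

variable (α : A ≃ₐ[K] A) (v : Subring.center A)

/-- The inclusion `A → R(A, α, v, 1)`. -/
noncomputable def coeff : A →+* AmbiskewRing α v :=
  (OreExtension.C (SkewPolyRing.beta α) (SkewPolyRing.delta α v)).comp (OreExtension.C _ _)

/-- The generator `y` of `R(A, α, v, 1)`. -/
noncomputable def y : AmbiskewRing α v :=
  OreExtension.C (SkewPolyRing.beta α) (SkewPolyRing.delta α v) (OreExtension.X _ _)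

/-- The generator `x` of `R(A, α, v, 1)`. -/
noncomputable def x : AmbiskewRing α v :=
  OreExtension.X _ _

/-- The Casimir element `z = x y - u` attached to a splitting element `u`. -/
noncomputable def casimir (u : A) : AmbiskewRing α v :=
  x α v * y α v - coeff α v u

end AmbiskewRing

/-- The skew Laurent polynomial ring `A[y^{±1}; α]`: finite sums `∑ aᵢ yⁱ` with `i ∈ ℤ` and
`y a = α(a) y`.  It is the skew group ring of `ℤ` over `A`, where `n ∈ ℤ` acts as `αⁿ`. -/
def SkewLaurent (_α : A ≃ₐ[K] A) : Type _ :=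
  SkewMonoidAlgebra A (Multiplicative ℤ)

noncomputable instance SkewLaurent.instRing (α : A ≃ₐ[K] A) : Ring (SkewLaurent α) :=
  letI : MulSemiringAction (Multiplicative ℤ) A :=
    MulSemiringAction.compHom A (zpowersHom (A ≃ₐ[K] A) α)
  inferInstanceAs (Ring (SkewMonoidAlgebra A (Multiplicative ℤ)))

/-- The constant `a` in `A[y^{±1}; α]`. -/
noncomputable def SkewLaurent.const (α : A ≃ₐ[K] A) (a : A) : SkewLaurent α :=
  SkewMonoidAlgebra.single (1 : Multiplicative ℤ) a

end Ambiskew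

section PrimeIdeals

variable {R : Type*} [Ring R]

/-- A two-sided ideal `P` of a noncommutative ring is prime if it is proper and
`a R b ⊆ P` implies `a ∈ P` or `b ∈ P`. -/
def IsPrimeIdeal (P : TwoSidedIdeal R) : Prop :=
  P ≠ ⊤ ∧ ∀ a b : R, (∀ r : R, a * r * b ∈ P) → a ∈ P ∨ b ∈ P

/-- `P` is completely prime: it is proper and `R/P` has no zero divisors. -/
def IsCompletelyPrimeIdeal (P : TwoSidedIdeal R) : Prop :=
  P ≠ ⊤ ∧ ∀ a b : R, a * b ∈ P → a ∈ P ∨ b ∈ P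

/-- `P` is a prime ideal of height one: its height in the set of prime ideals of `R`,
ordered by inclusion, is `1`. -/
def IsHeightOnePrime (P : TwoSidedIdeal R) : Prop :=
  ∃ hP : IsPrimeIdeal P,
    Order.height (⟨P, hP⟩ : {Q : TwoSidedIdeal R // IsPrimeIdeal Q}) = 1

/-- `p` is a prime element of `R`: it is nonzero, `p R = R p`, this is a height one prime ideal,
and it is completely prime. `P` is the ideal that it generates. -/
structure IsPrimeGenerator (p : R) (P : TwoSidedIdeal R) : Prop where
  ne_zero : p ≠ 0
  eq_right : (P : Set R) = Set.range fun r : R => p * r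
  eq_left : (P : Set R) = Set.range fun r : R => r * p
  heightOne : IsHeightOnePrime P
  completelyPrime : IsCompletelyPrimeIdeal P

variable (R) in
/-- Unique factorisation domain in the sense of Chatters: a (not necessarily commutative) domain
with at least one height one prime ideal, in which every height one prime ideal is generated by a
prime element, that is, `P = p R = R p` with `R/P` a domain.  No chain condition is included. -/
structure IsChattersUFD : Prop where
  isDomain : IsDomain R
  exists_heightOne : ∃ P : TwoSidedIdeal R, IsHeightOnePrime P
  heightOne_generated : ∀ P : TwoSidedIdeal R, IsHeightOnePrime P → ∃ p : R, IsPrimeGenerator p P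

end PrimeIdeals

/-! Write `L` for `A[y^{±1}; α]`. Telescoping gives `v⁽ᵐ⁾ = u - αᵐ(u)`, so `xy = z + u` and `yx = z
+ α(u)` with `z` central. Sending `y ↦ y` and `x ↦ (z + u) y⁻¹` maps `R` to `L[z]`, and specialising
`z` to `c ∈ K` gives a map `R → L`.

The kernel of the specialisation is `(z - c)R` (`toLaurent_eq_zero_iff`), and `L` has no zero
divisors, so `(z - c)R` is completely prime. Moreover `z - c` has degree one in `x`, so nothing
nonzero is divisible by all its powers (`eq_zero_of_forall_exists_casimir_mul`). This shows that `R
→ L[z]` is injective, and also that no nonzero prime lies strictly inside `(z - c)R`.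

Conversely, every nonzero prime `P` contains some `z - c`. Inverting `y` turns `P` into a nonzero
ideal of `L[z]`. As `L` is simple with centre `K`, that ideal meets `K[z]` nontrivially
(`TwoSidedIdeal.exists_ne_zero_coeff_mem_center`), so `p(z) yⁿ ∈ P` for some `p ≠ 0`. Since `K` is
algebraically closed and `z` is central, either some `z - c` lies in `P` or `yⁿ ∈ P`. In the second
case, commuting `yⁿ` with `x` and using the polynomials in `u` divisible by `v⁽ⁿ⁾` lowers `n`
(`exists_casimir_sub_mem_of_pow_mem`); the descent cannot reach `y⁰ = 1`. -/

namespace OreExtension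

/-! ### Degrees and leading coefficients in Ore extensions. -/

variable {B : Type*} [Ring B] {σ : B →+* B} {δ : SkewDerivation σ}

theorem induction_on {p : OreExtension σ δ → Prop} (f : OreExtension σ δ) (h0 : p 0)
    (hadd : ∀ f g, p f → p g → p (f + g)) (hm : ∀ i b, p (monomial σ δ i b)) : p f :=
  Finsupp.induction_linear (motive := p) f h0 hadd hm

/-- `p` has degree at most `m`, and `b` is its coefficient of degree `m`. -/
def HasTop (p : ℕ →₀ B) (m : ℕ) (b : B) : Prop :=
  p m = b ∧ ∀ k, m < k → p k = 0

theorem exists_hasTop {p : ℕ →₀ B} (hp : p ≠ 0) : ∃ m b, b ≠ 0 ∧ HasTop p m b := by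
  have hs : p.support.Nonempty := Finsupp.support_nonempty_iff.2 hp
  refine ⟨p.support.max' hs, _, Finsupp.mem_support_iff.1 (p.support.max'_mem hs), rfl, ?_⟩
  intro k hk
  by_contra h
  exact absurd (p.support.le_max' k (Finsupp.mem_support_iff.2 h)) (not_le.2 hk)

theorem HasTop.ne_zero {p : ℕ →₀ B} {m : ℕ} {b : B} (h : HasTop p m b) (hb : b ≠ 0) : p ≠ 0 := by
  rintro rfl
  exact hb h.1.symm

theorem HasTop.degree_unique {p : ℕ →₀ B} {m n : ℕ} {b c : B} (h : HasTop p m b)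
    (h' : HasTop p n c) (hb : b ≠ 0) (hc : c ≠ 0) : m = n := by
  rcases lt_trichotomy m n with hl | hl | hl
  · exact absurd (h'.1.symm.trans (h.2 n hl)) hc
  · exact hl
  · exact absurd (h.1.symm.trans (h'.2 m hl)) hb

theorem varMul_apply_succ (q : ℕ →₀ B) (k : ℕ) :
    varMul σ δ q (k + 1) = σ (q k) + δ.toAddHom (q (k + 1)) := by
  induction q using Finsupp.induction_linear with
  | zero => simp
  | add p q hp hq => simp only [map_add, Finsupp.add_apply, hp, hq]; abel
  | single i c =>
    rw [varMul_single, Finsupp.add_apply, Finsupp.single_apply, Finsupp.single_apply,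
      Finsupp.single_apply, Finsupp.single_apply]
    simp only [add_left_inj, apply_ite σ, apply_ite δ.toAddHom, map_zero]

theorem HasTop.varMul {q : ℕ →₀ B} {n : ℕ} {b : B} (h : HasTop q n b) :
    HasTop (OreExtension.varMul σ δ q) (n + 1) (σ b) := by
  refine ⟨?_, fun k hk => ?_⟩
  · rw [varMul_apply_succ, h.1, h.2 (n + 1) (Nat.lt_succ_self n), map_zero, add_zero]
  · obtain ⟨k, rfl⟩ : ∃ j, k = j + 1 := ⟨k - 1, by omega⟩
    rw [varMul_apply_succ, h.2 k (by omega), h.2 (k + 1) (by omega), map_zero, map_zero, add_zero]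

theorem HasTop.varMul_iterate {q : ℕ →₀ B} {n : ℕ} {b : B} (h : HasTop q n b) (i : ℕ) :
    HasTop ((OreExtension.varMul σ δ)^[i] q) (i + n) (σ^[i] b) := by
  induction i with
  | zero => simpa using h
  | succ i ih =>
    rw [Function.iterate_succ_apply', Function.iterate_succ_apply', add_right_comm]
    exact ih.varMul

/-- Moving `xᵐ` past `b` produces `σᵐ(b) xᵐ` plus lower terms, and only the top term of `p` can
reach degree `m + n`. Hence degrees add when `B` is a domain and `σ` is injective. -/
theorem HasTop.mul {p q : ℕ →₀ B} {m n : ℕ} {a b : B} (hp : HasTop p m a) (hq : HasTop q n b) :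
    HasTop (OreExtension.mul σ δ p q) (m + n) (a * σ^[m] b) := by
  have hle : ∀ i ∈ p.support, i ≤ m := fun i hi => by
    by_contra h
    exact Finsupp.mem_support_iff.1 hi (hp.2 i (not_le.1 h))
  refine ⟨?_, fun k hk => ?_⟩
  · rw [OreExtension.mul, Finsupp.sum_apply, Finsupp.sum, Finset.sum_eq_single m]
    · rw [Finsupp.smul_apply, (hq.varMul_iterate m).1, hp.1, smul_eq_mul]
    · intro i hi him
      have := lt_of_le_of_ne (hle i hi) him
      rw [Finsupp.smul_apply, (hq.varMul_iterate i).2 _ (by omega), smul_zero]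
    · intro hm
      rw [Finsupp.notMem_support_iff.1 hm, zero_smul, Finsupp.zero_apply]
  · rw [OreExtension.mul, Finsupp.sum_apply, Finsupp.sum]
    refine Finset.sum_eq_zero fun i hi => ?_
    have := hle i hi
    rw [Finsupp.smul_apply, (hq.varMul_iterate i).2 _ (by omega), smul_zero]

theorem isDomain [IsDomain B] (hσ : Function.Injective σ) : IsDomain (OreExtension σ δ) := by
  have : Nontrivial (OreExtension σ δ) :=
    ⟨⟨0, 1, fun h => zero_ne_one (α := B) (by
      have := DFunLike.congr_fun (show (0 : ℕ →₀ B) = Finsupp.single 0 1 from h) 0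
      simp at this)⟩⟩
  have : NoZeroDivisors (OreExtension σ δ) := by
    refine ⟨fun {p q} h => ?_⟩
    by_contra! hn
    obtain ⟨m, a, ha, hp⟩ := exists_hasTop (p := (p : ℕ →₀ B)) hn.1
    obtain ⟨n, b, hb, hq⟩ := exists_hasTop (p := (q : ℕ →₀ B)) hn.2
    refine (hp.mul (σ := σ) (δ := δ) hq).ne_zero (mul_ne_zero ha fun h0 => hb ?_) h
    exact hσ.iterate m (h0.trans (iterate_map_zero σ m).symm)
  exact NoZeroDivisors.to_isDomain _

/-- An element whose multiples can only be infinitely divisible by it if they vanish: a divisor of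
positive degree strictly lowers the degree of the quotient. -/
theorem eq_zero_of_forall_exists_mul [IsDomain B] (hσ : Function.Injective σ)
    {w : OreExtension σ δ} {m : ℕ} {c : B} (hw : HasTop (w : ℕ →₀ B) m c) (hc : c ≠ 0) (hm : 0 < m)
    (S : Set (OreExtension σ δ)) (hS : ∀ f ∈ S, ∃ g ∈ S, f = w * g)
    {f : OreExtension σ δ} (hf : f ∈ S) : f = 0 := by
  have key : ∀ n : ℕ, ∀ f ∈ S, ∀ b : B, b ≠ 0 → ¬ HasTop (f : ℕ →₀ B) n b := by
    intro n
    induction n using Nat.strong_induction_on with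
    | _ n ih =>
      intro f hf b hb hfb
      obtain ⟨g, hg, rfl⟩ := hS f hf
      have hg0 : g ≠ 0 := by
        rintro rfl
        exact hfb.ne_zero hb (mul_zero w)
      obtain ⟨k, a, ha, hga⟩ := exists_hasTop (p := (g : ℕ →₀ B)) hg0
      have h0 : c * σ^[m] a ≠ 0 := mul_ne_zero hc fun h0 =>
        ha (hσ.iterate m (h0.trans (iterate_map_zero σ m).symm))
      have := (hw.mul (σ := σ) (δ := δ) hga).degree_unique hfb h0 hb
      exact ih k (by omega) g hg a ha hga
  by_contra h
  obtain ⟨n, b, hb, hfb⟩ := exists_hasTop (p := (f : ℕ →₀ B)) h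
  exact key n f hf b hb hfb

/-! ### Relations in an Ore extension and its universal property. -/

theorem C_mul_monomial (a : B) (i : ℕ) (b : B) :
    C σ δ a * monomial σ δ i b = monomial σ δ i (a * b) := by
  change OreExtension.mul σ δ (Finsupp.single 0 a) (Finsupp.single i b) = Finsupp.single i (a * b)
  rw [mul_single, Function.iterate_zero_apply, Finsupp.smul_single, smul_eq_mul]

theorem X_mul_monomial (i : ℕ) (b : B) :
    X σ δ * monomial σ δ i b = monomial σ δ (i + 1) (σ b) + monomial σ δ i (δ.toAddHom b) := by
  change OreExtension.mul σ δ (Finsupp.single 1 1) (Finsupp.single i b) =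
    Finsupp.single (i + 1) (σ b) + Finsupp.single i (δ.toAddHom b)
  rw [mul_single, Function.iterate_one, one_smul, varMul_single]

theorem X_pow (i : ℕ) : X σ δ ^ i = monomial σ δ i 1 := by
  have h1 : δ.toAddHom 1 = 0 := by simpa using δ.leibniz 1 1
  induction i with
  | zero => rfl
  | succ i ih =>
    rw [pow_succ', ih, X_mul_monomial, map_one, h1]
    exact add_eq_left.2 (Finsupp.single_zero i)

theorem monomial_eq (i : ℕ) (b : B) : monomial σ δ i b = C σ δ b * X σ δ ^ i := by
  rw [X_pow, C_mul_monomial, mul_one]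

theorem X_mul_C (b : B) : X σ δ * C σ δ b = C σ δ (σ b) * X σ δ + C σ δ (δ.toAddHom b) := by
  have := X_mul_monomial (σ := σ) (δ := δ) 0 b
  rw [monomial_eq (0 + 1), zero_add, pow_one] at this
  exact this

section lift

variable {S : Type*} [Ring S]

/-- The additive map `∑ bᵢ xⁱ ↦ ∑ f(bᵢ) sⁱ`. -/
noncomputable def liftAdd (f : B →+* S) (s : S) : OreExtension σ δ →+ S :=
  (Finsupp.liftAddHom fun i => (AddMonoidHom.mulRight (s ^ i)).comp (f : B →+ S) : (ℕ →₀ B) →+ S)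

theorem liftAdd_monomial (f : B →+* S) (s : S) (i : ℕ) (b : B) :
    liftAdd f s (monomial σ δ i b) = f b * s ^ i :=
  Finsupp.liftAddHom_apply_single _ _ _

/-- The universal property of `B[x; σ, δ]`: a ring homomorphism `f` on `B` extends by `x ↦ s` when
`s f(b) = f(σ b) s + f(δ b)`. -/
noncomputable def lift (f : B →+* S) (s : S)
    (h : ∀ b, s * f b = f (σ b) * s + f (δ.toAddHom b)) : OreExtension σ δ →+* S where
  __ := liftAdd f s
  map_one' := by
    change liftAdd f s (monomial σ δ 0 1) = 1
    rw [liftAdd_monomial, map_one, pow_zero, mul_one]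
  map_mul' p q := by
    change liftAdd f s (p * q) = liftAdd f s p * liftAdd f s q
    -- Multiplicativity is checked for a left factor in `B`, then for `x` (where the hypothesis `h`
    -- enters), then for `xⁱ`; these generate all left factors additively.
    have hC : ∀ b (q : OreExtension σ δ), liftAdd f s (C σ δ b * q) = f b * liftAdd f s q := by
      intro b q
      induction q using induction_on with
      | h0 => simp
      | hadd p q hp hq => rw [mul_add, map_add, hp, hq, map_add, mul_add]
      | hm i c => rw [C_mul_monomial, liftAdd_monomial, liftAdd_monomial, map_mul, mul_assoc]
    have hX : ∀ q : OreExtension σ δ, liftAdd f s (X σ δ * q) = s * liftAdd f s q := by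
      intro q
      induction q using induction_on with
      | h0 => simp
      | hadd p q hp hq => rw [mul_add, map_add, hp, hq, map_add, mul_add]
      | hm i c =>
        rw [X_mul_monomial, map_add, liftAdd_monomial, liftAdd_monomial, liftAdd_monomial,
          ← mul_assoc s, h, add_mul, pow_succ', mul_assoc]
    have hXi : ∀ (i : ℕ) (q : OreExtension σ δ),
        liftAdd f s (X σ δ ^ i * q) = s ^ i * liftAdd f s q := by
      intro i q
      induction i with
      | zero => simp
      | succ i ih => rw [pow_succ', mul_assoc, hX, ih, pow_succ', mul_assoc]
    induction p using induction_on with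
    | h0 => simp
    | hadd p p' hp hp' => rw [add_mul, map_add, hp, hp', map_add, add_mul]
    | hm i b => rw [monomial_eq, mul_assoc, hC, hXi, ← monomial_eq, liftAdd_monomial, mul_assoc]

variable {f : B →+* S} {s : S} {h : ∀ b, s * f b = f (σ b) * s + f (δ.toAddHom b)}

theorem lift_C (b : B) : lift f s h (C σ δ b) = f b := by
  refine (liftAdd_monomial (σ := σ) (δ := δ) f s 0 b).trans ?_
  rw [pow_zero, mul_one]

theorem lift_X : lift f s h (X σ δ) = s := by
  refine (liftAdd_monomial (σ := σ) (δ := δ) f s 1 1).trans ?_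
  rw [map_one, pow_one, one_mul]

end lift

end OreExtension

/-! ### The ambiskew ring: domain property, defining relations, spanning monomials. -/

section Ambiskew

variable {K A : Type*} [Field K] [Ring A] [Algebra K A]

theorem SkewPolyRing.isDomain [IsDomain A] (α : A ≃ₐ[K] A) : IsDomain (SkewPolyRing α) :=
  OreExtension.isDomain (σ := (α : A →+* A)) α.injective

theorem SkewPolyRing.beta_injective (α : A ≃ₐ[K] A) : Function.Injective (beta α) :=
  Finsupp.mapRange_injective _ (map_zero _) α.symm.injective

theorem SkewPolyRing.beta_C (α : A ≃ₐ[K] A) (a : A) :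
    beta α (OreExtension.C _ _ a) = OreExtension.C _ _ (α.symm a) :=
  betaAddHom_monomial α 0 a

theorem SkewPolyRing.beta_X (α : A ≃ₐ[K] A) : beta α (OreExtension.X _ _) = OreExtension.X _ _ :=
  (betaAddHom_monomial α 1 1).trans (by rw [map_one]; rfl)

theorem SkewPolyRing.delta_C (α : A ≃ₐ[K] A) (v : Subring.center A) (a : A) :
    (delta α v).toAddHom (OreExtension.C _ _ a) = 0 := by
  refine (deltaAddHom_monomial α v 0 a).trans ?_
  rw [iterV, Finset.range_zero, Finset.sum_empty, mul_zero]
  exact monomial_zero α 0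

theorem SkewPolyRing.delta_X (α : A ≃ₐ[K] A) (v : Subring.center A) :
    (delta α v).toAddHom (OreExtension.X _ _) = OreExtension.C _ _ (v : A) := by
  refine (deltaAddHom_monomial α v 1 1).trans ?_
  rw [iterV, Finset.sum_range_one, map_one, one_mul, pow_zero]
  rfl

namespace AmbiskewRing

theorem isDomain [IsDomain A] (α : A ≃ₐ[K] A) (v : Subring.center A) :
    IsDomain (AmbiskewRing α v) :=
  have := SkewPolyRing.isDomain α
  OreExtension.isDomain (SkewPolyRing.beta_injective α)

variable {α : A ≃ₐ[K] A} {v : Subring.center A}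

theorem y_mul_coeff (a : A) : y α v * coeff α v a = coeff α v (α a) * y α v := by
  have h := OreExtension.X_mul_C (σ := (α : A →+* A)) (δ := SkewDerivation.zero _) a
  have h0 : (SkewDerivation.zero (α : A →+* A)).toAddHom a = 0 := rfl
  rw [h0, map_zero, add_zero] at h
  have h' := congrArg (OreExtension.C (SkewPolyRing.beta α) (SkewPolyRing.delta α v)) h
  rwa [map_mul, map_mul] at h'

theorem x_mul_coeff (a : A) : x α v * coeff α v a = coeff α v (α.symm a) * x α v := by
  have h := OreExtension.X_mul_C (σ := SkewPolyRing.beta α) (δ := SkewPolyRing.delta α v)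
    (OreExtension.C _ _ a)
  rwa [SkewPolyRing.beta_C, SkewPolyRing.delta_C, map_zero, add_zero] at h

theorem x_mul_y : x α v * y α v = y α v * x α v + coeff α v v := by
  have h := OreExtension.X_mul_C (σ := SkewPolyRing.beta α) (δ := SkewPolyRing.delta α v)
    (OreExtension.X _ _)
  rwa [SkewPolyRing.beta_X, SkewPolyRing.delta_X] at h

theorem induction_on {p : AmbiskewRing α v → Prop} (f : AmbiskewRing α v)
    (hadd : ∀ f g, p f → p g → p (f + g))
    (hm : ∀ a i j, p (coeff α v a * y α v ^ i * x α v ^ j)) : p f := by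
  have h0 : p 0 := by simpa using hm 0 0 0
  induction f using OreExtension.induction_on with
  | h0 => exact h0
  | hadd f g hf hg => exact hadd f g hf hg
  | hm j b =>
    rw [OreExtension.monomial_eq]
    induction b using SkewPolyRing.induction_on with
    | h0 => rwa [map_zero, zero_mul]
    | hadd b c hb hc => rw [map_add, add_mul]; exact hadd _ _ hb hc
    | hm i a =>
      have := hm a i j
      rwa [OreExtension.monomial_eq, map_mul, map_pow]

end AmbiskewRing

/-! ### Coefficients and zero divisors in the skew Laurent ring. -/

namespace SkewLaurent

variable {α : A ≃ₐ[K] A}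

/-- The monomial `a yⁿ` of `A[y^{±1}; α]`. -/
noncomputable def mono (α : A ≃ₐ[K] A) (n : ℤ) (a : A) : SkewLaurent α :=
  SkewMonoidAlgebra.single (Multiplicative.ofAdd n) a

/-- The coefficients of an element of `A[y^{±1}; α]`. -/
noncomputable def coeffs (α : A ≃ₐ[K] A) : SkewLaurent α →+ (ℤ →₀ A) where
  toFun f := SkewMonoidAlgebra.coeff f
  map_zero' := SkewMonoidAlgebra.coeff_zero
  map_add' := SkewMonoidAlgebra.coeff_add

theorem coeffs_injective : Function.Injective (coeffs α) :=
  SkewMonoidAlgebra.coeff_injective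

theorem coeffs_mono (n : ℤ) (a : A) : coeffs α (mono α n a) = Finsupp.single n a :=
  rfl

theorem mono_mul_mono (m n : ℤ) (a b : A) :
    mono α m a * mono α n b = mono α (m + n) (a * (α ^ m) b) :=
  letI : MulSemiringAction (Multiplicative ℤ) A :=
    MulSemiringAction.compHom A (zpowersHom (A ≃ₐ[K] A) α)
  SkewMonoidAlgebra.single_mul_single

theorem mono_add (n : ℤ) (a b : A) : mono α n (a + b) = mono α n a + mono α n b :=
  SkewMonoidAlgebra.single_add n a b

theorem mono_zero (n : ℤ) : mono α n 0 = 0 :=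
  SkewMonoidAlgebra.single_zero n

theorem mono_one : mono α 0 1 = 1 :=
  rfl

theorem induction_on {p : SkewLaurent α → Prop} (f : SkewLaurent α) (h0 : p 0)
    (hadd : ∀ f g, p f → p g → p (f + g)) (hm : ∀ n a, p (mono α n a)) : p f :=
  SkewMonoidAlgebra.induction_on (p := p) f h0 hm (fun {f g} => hadd f g)

theorem coeffs_mul (f g : SkewLaurent α) (k : ℤ) :
    coeffs α (f * g) k = (coeffs α f).sum fun i a => a * (α ^ i) (coeffs α g (k - i)) := by
  induction f using induction_on with
  | h0 => simp
  | hadd f f' hf hf' =>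
    rw [add_mul, map_add, Finsupp.add_apply, hf, hf', map_add, Finsupp.sum_add_index']
    · simp
    · simp [add_mul]
  | hm m a =>
    rw [coeffs_mono, Finsupp.sum_single_index (by simp)]
    induction g using induction_on with
    | h0 => simp
    | hadd g g' hg hg' => simp only [mul_add, map_add, Finsupp.add_apply, hg, hg']
    | hm n b =>
      rw [mono_mul_mono, coeffs_mono, coeffs_mono, Finsupp.single_apply, Finsupp.single_apply]
      by_cases h : m + n = k
      · rw [if_pos h, if_pos (by omega)]
      · rw [if_neg h, if_neg (by omega), map_zero, mul_zero]

theorem exists_top {p : ℤ →₀ A} (hp : p ≠ 0) : ∃ m, p m ≠ 0 ∧ ∀ k, m < k → p k = 0 := by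
  have hs : p.support.Nonempty := Finsupp.support_nonempty_iff.2 hp
  refine ⟨p.support.max' hs, Finsupp.mem_support_iff.1 (p.support.max'_mem hs), ?_⟩
  intro k hk
  by_contra h
  exact absurd (p.support.le_max' k (Finsupp.mem_support_iff.2 h)) (not_le.2 hk)

/-- The exponents are totally ordered, so the top terms `a yᵐ` and `b yⁿ` alone contribute to degree
`m + n`, with coefficient `a αᵐ(b) ≠ 0`. -/
theorem eq_zero_or_eq_zero_of_mul_eq_zero [IsDomain A] {f g : SkewLaurent α} (h : f * g = 0) :
    f = 0 ∨ g = 0 := by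
  by_contra! hn
  obtain ⟨m, hm, hm'⟩ := exists_top
    (fun h0 => hn.1 (coeffs_injective (h0.trans (map_zero (coeffs α)).symm)))
  obtain ⟨n, hn, hn'⟩ := exists_top
    (fun h0 => hn.2 (coeffs_injective (h0.trans (map_zero (coeffs α)).symm)))
  have key := coeffs_mul f g (m + n)
  rw [h, map_zero, Finsupp.zero_apply, Finsupp.sum, Finset.sum_eq_single m] at key
  · rw [add_sub_cancel_left] at key
    rcases mul_eq_zero.1 key.symm with h0 | h0
    · exact hm h0
    · exact hn ((map_eq_zero_iff _ (α ^ m).injective).1 h0)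
  · intro i hi him
    have : i ≤ m := by
      by_contra h
      exact Finsupp.mem_support_iff.1 hi (hm' i (not_le.1 h))
    rw [hn' _ (by omega), map_zero, mul_zero]
  · intro h0
    exact absurd (Finsupp.notMem_support_iff.1 h0) hm

end SkewLaurent

end Ambiskew

/-! ### Homomorphisms out of `R`, the central Casimir element, normal forms modulo `z - c`. -/

section Ambiskew

variable {K A : Type*} [Field K] [Ring A] [Algebra K A]

theorem iterV_eq_sub (α : A ≃ₐ[K] A) {u v : A} (hv : v = u - α u) (m : ℕ) :
    iterV α v m = u - (α ^ m) u := by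
  induction m with
  | zero => simp [iterV]
  | succ m ih =>
    rw [iterV, Finset.sum_range_succ, ← iterV, ih, hv, map_sub, pow_succ, AlgEquiv.mul_apply]
    abel

namespace AmbiskewRing

section lift

variable {S : Type*} [Ring S] {α : A ≃ₐ[K] A} {u v : Subring.center A} {f : A →+* S} {Y : Sˣ}
  {w : S}

theorem pow_mul_of_skew (hY : ∀ a, Y * f a = f (α a) * Y) (m : ℕ) (a : A) :
    (Y : S) ^ m * f a = f ((α ^ m) a) * (Y : S) ^ m := by
  induction m with
  | zero => simp
  | succ m ih => rw [pow_succ', mul_assoc, ih, ← mul_assoc, hY, mul_assoc, pow_succ' α]; rfl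

/-- The homomorphism `A[y; α] → S` that is `f` on `A` and sends `y` to `Y`. -/
noncomputable def liftSkewPoly (hY : ∀ a, Y * f a = f (α a) * Y) : SkewPolyRing α →+* S :=
  OreExtension.lift f (Y : S) fun b => by
    have h0 : (SkewDerivation.zero (α : A →+* A)).toAddHom b = 0 := rfl
    rw [h0, map_zero, add_zero]
    exact hY b

theorem liftSkewPoly_monomial (hY : ∀ a, Y * f a = f (α a) * Y) (m : ℕ) (a : A) :
    liftSkewPoly hY (OreExtension.monomial _ _ m a) = f a * (Y : S) ^ m :=
  OreExtension.liftAdd_monomial _ _ _ _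

/-- This is the relation needed to send `x` to `s = (w + u) Y⁻¹`. On `a yᵐ`, `s a Yᵐ = β(a)(w + u)
Yᵐ⁻¹` while `β(a) Yᵐ s = β(a)(w + αᵐ(u)) Yᵐ⁻¹`, and the difference is `β(a) v⁽ᵐ⁾ Yᵐ⁻¹`. -/
theorem liftSkewPoly_skew (hv : (v : A) = (u : A) - α (u : A))
    (hY : ∀ a, Y * f a = f (α a) * Y) (hw : ∀ s, w * s = s * w) (b : SkewPolyRing α) :
    (w + f u) * (Y⁻¹ : Sˣ) * liftSkewPoly hY b =
      liftSkewPoly hY (SkewPolyRing.beta α b) * ((w + f u) * (Y⁻¹ : Sˣ)) +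
        liftSkewPoly hY ((SkewPolyRing.delta α v).toAddHom b) := by
  induction b using SkewPolyRing.induction_on with
  | h0 => simp
  | hadd b c hb hc => rw [map_add, mul_add, hb, hc]; simp only [map_add, add_mul]; abel
  | hm m a =>
    have hY' : ∀ a, (Y⁻¹ : Sˣ) * f a = f (α.symm a) * (Y⁻¹ : Sˣ) := fun a => by
      rw [Units.inv_mul_eq_iff_eq_mul, ← mul_assoc, hY, AlgEquiv.apply_symm_apply, mul_assoc,
        Units.mul_inv, mul_one]
    have hu : ∀ a, f u * f a = f a * f u := fun a => by
      rw [← map_mul, ← map_mul, Subring.mem_center_iff.1 u.2 a]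
    have e1 : SkewPolyRing.beta α (OreExtension.monomial _ _ m a) =
      OreExtension.monomial _ _ m (α.symm a) := SkewPolyRing.betaAddHom_monomial α m a
    have e2 : (SkewPolyRing.delta α v).toAddHom (OreExtension.monomial _ _ m a) =
      OreExtension.monomial _ _ (m - 1) (α.symm a * iterV α v m) :=
      SkewPolyRing.deltaAddHom_monomial α v m a
    rw [e1, e2, liftSkewPoly_monomial, liftSkewPoly_monomial, liftSkewPoly_monomial,
      iterV_eq_sub α hv]
    have hL : (w + f u) * (Y⁻¹ : Sˣ) * (f a * (Y : S) ^ m) =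
        f (α.symm a) * (w + f u) * ((Y⁻¹ : Sˣ) * (Y : S) ^ m) := by
      have : (w + f u) * f (α.symm a) = f (α.symm a) * (w + f u) := by
        rw [add_mul, mul_add, hw, hu]
      rw [← mul_assoc, mul_assoc _ _ (f a), hY', ← mul_assoc, this]
      simp only [mul_assoc]
    have hR : f (α.symm a) * (Y : S) ^ m * ((w + f u) * (Y⁻¹ : Sˣ)) =
        f (α.symm a) * (w + f ((α ^ m) u)) * ((Y : S) ^ m * (Y⁻¹ : Sˣ)) := by
      have : (Y : S) ^ m * (w + f u) = (w + f ((α ^ m) u)) * (Y : S) ^ m := by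
        rw [add_mul, mul_add, hw, pow_mul_of_skew hY]
      rw [mul_assoc, ← mul_assoc _ _ (↑Y⁻¹ : S), this]
      simp only [mul_assoc]
    rw [hL, hR]
    -- For `m = 0` the truncated exponent `m - 1` is harmless, its coefficient being zero.
    rcases m with _ | m
    · simp
    · rw [pow_succ' (Y : S), Units.inv_mul_cancel_left, ← pow_succ' (Y : S), pow_succ (Y : S),
        Units.mul_inv_cancel_right, Nat.add_sub_cancel, map_mul, map_sub]
      noncomm_ring

/-- The homomorphism `R(A, α, v, 1) → S` that is `f` on `A`, sends `y` to the unit `Y` and the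
Casimir element to the central element `w`. -/
noncomputable def lift (hv : (v : A) = (u : A) - α (u : A))
    (hY : ∀ a, Y * f a = f (α a) * Y) (hw : ∀ s, w * s = s * w) : AmbiskewRing α v →+* S :=
  OreExtension.lift (liftSkewPoly hY) ((w + f u) * (Y⁻¹ : Sˣ)) (liftSkewPoly_skew hv hY hw)

variable (hv : (v : A) = (u : A) - α (u : A)) (hY : ∀ a, Y * f a = f (α a) * Y)
  (hw : ∀ s, w * s = s * w)

theorem lift_coeff (a : A) : lift hv hY hw (coeff α v a) = f a :=
  OreExtension.lift_C _ |>.trans (OreExtension.lift_C a)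

theorem lift_y : lift hv hY hw (y α v) = Y :=
  OreExtension.lift_C _ |>.trans OreExtension.lift_X

theorem lift_x : lift hv hY hw (x α v) = (w + f u) * (Y⁻¹ : Sˣ) :=
  OreExtension.lift_X

theorem lift_casimir : lift hv hY hw (casimir α v (u : A)) = w := by
  rw [casimir, map_sub, map_mul, lift_x, lift_y, lift_coeff, Units.inv_mul_cancel_right,
    add_sub_cancel_right]

end lift

variable {α : A ≃ₐ[K] A} {u v : Subring.center A}

theorem ringHom_ext {S : Type*} [Ring S] {f g : AmbiskewRing α v →+* S}
    (hc : ∀ a, f (coeff α v a) = g (coeff α v a)) (hy : f (y α v) = g (y α v))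
    (hx : f (x α v) = g (x α v)) : f = g := by
  ext r
  induction r using induction_on with
  | hadd r s hr hs => rw [map_add, map_add, hr, hs]
  | hm a i j => simp only [map_mul, map_pow, hc, hx, hy]

theorem commute_of_generators {w : AmbiskewRing α v} (hc : ∀ a, Commute w (coeff α v a))
    (hy : Commute w (y α v)) (hx : Commute w (x α v)) (r : AmbiskewRing α v) : Commute w r := by
  induction r using induction_on with
  | hadd r s hr hs => exact hr.add_right hs
  | hm a i j => exact ((hc a).mul_right (hy.pow_right i)).mul_right (hx.pow_right j)

theorem commute_algebraMap (c : K) (r : AmbiskewRing α v) :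
    Commute (coeff α v (algebraMap K A c)) r := by
  refine commute_of_generators (fun a => ?_) ?_ ?_ r
  · rw [commute_iff_eq, ← map_mul, ← map_mul, Algebra.commutes]
  · rw [commute_iff_eq, y_mul_coeff, AlgEquiv.commutes]
  · rw [commute_iff_eq, x_mul_coeff, AlgEquiv.commutes]

theorem x_mul_y_eq (u : A) : x α v * y α v = casimir α v u + coeff α v u :=
  (sub_add_cancel _ _).symm

section Casimir

variable (hv : (v : A) = (u : A) - α (u : A))
include hv

theorem y_mul_x_eq : y α v * x α v = casimir α v (u : A) + coeff α v (α u) := by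
  rw [casimir, x_mul_y, hv, map_sub]
  abel

/-- On `A` the automorphisms attached to `x` and `y` cancel. For `y`, compare `y(xy)` with `(yx)y`
using `xy = z + u` and `yx = z + α(u)`; the terms in `u` cancel. The case of `x` is symmetric. -/
theorem commute_casimir (r : AmbiskewRing α v) : Commute (casimir α v (u : A)) r := by
  have hu : ∀ a, coeff α v u * coeff α v a = coeff α v a * coeff α v u := fun a => by
    rw [← map_mul, ← map_mul, Subring.mem_center_iff.1 u.2 a]
  refine commute_of_generators (fun a => ?_) ?_ ?_ r
  · rw [commute_iff_eq, casimir, sub_mul, mul_sub, hu, mul_assoc, y_mul_coeff, ← mul_assoc,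
      x_mul_coeff, AlgEquiv.symm_apply_apply, mul_assoc]
  · have h := (mul_assoc (y α v) (x α v) (y α v)).symm
    rw [y_mul_x_eq hv, x_mul_y_eq (u : A), mul_add, add_mul, y_mul_coeff] at h
    exact (add_right_cancel h).symm
  · have h := mul_assoc (x α v) (y α v) (x α v)
    rw [y_mul_x_eq hv, x_mul_y_eq (u : A), mul_add, add_mul, x_mul_coeff,
      AlgEquiv.symm_apply_apply] at h
    exact add_right_cancel h

theorem commute_casimir_sub (c : K) (r : AmbiskewRing α v) :
    Commute (casimir α v (u : A) - coeff α v (algebraMap K A c)) r :=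
  (commute_casimir hv r).sub_left (commute_algebraMap c r)

end Casimir

theorem coeff_mul_pow_y (i : ℕ) (a : A) :
    y α v ^ i * coeff α v a = coeff α v ((α ^ i) a) * y α v ^ i := by
  induction i with
  | zero => simp
  | succ i ih =>
    rw [pow_succ', mul_assoc, ih, ← mul_assoc, y_mul_coeff, mul_assoc, pow_succ' α]; rfl

/-- `yⁿ` for `n ≥ 0` and `x⁻ⁿ` for `n < 0`. -/
noncomputable def zpowYX (α : A ≃ₐ[K] A) (v : Subring.center A) : ℤ → AmbiskewRing α v
  | .ofNat n => y α v ^ n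
  | .negSucc n => x α v ^ (n + 1)

theorem zpowYX_neg (n : ℕ) : zpowYX α v (-(n : ℤ)) = x α v ^ n := by
  rcases n with _ | n
  · exact (pow_zero (y α v)).trans (pow_zero (x α v)).symm
  · rfl

/-- Replacing an inner `yx` by `(z - c) + (α(u) + c)` lowers both exponents by one, up to a multiple
of the central element `z - c`. The process stops when only a power of `y` or of `x` is left. -/
theorem exists_monomial_eq (hv : (v : A) = (u : A) - α (u : A)) (c : K) (i j : ℕ) (a : A) :
    ∃ n b r, coeff α v a * y α v ^ i * x α v ^ j = coeff α v b * zpowYX α v n +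
      (casimir α v (u : A) - coeff α v (algebraMap K A c)) * r := by
  induction i generalizing j a with
  | zero => exact ⟨-j, a, 0, by simp [zpowYX_neg]⟩
  | succ i ih =>
    rcases j with _ | j
    · exact ⟨(i + 1 : ℕ), a, 0, by simp [zpowYX]⟩
    obtain ⟨n, b, r, h⟩ := ih j (a * (α ^ i) (α u + algebraMap K A c))
    refine ⟨n, b, r + coeff α v a * y α v ^ i * x α v ^ j, ?_⟩
    have e : y α v * x α v = (casimir α v (u : A) - coeff α v (algebraMap K A c)) +
        coeff α v (α u + algebraMap K A c) := by
      rw [y_mul_x_eq hv, map_add]; abel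
    rw [pow_succ (y α v), pow_succ' (x α v)]
    calc coeff α v a * (y α v ^ i * y α v) * (x α v * x α v ^ j)
        = coeff α v a * y α v ^ i * (y α v * x α v) * x α v ^ j := by simp only [mul_assoc]
      _ = coeff α v a * (y α v ^ i * coeff α v (α u + algebraMap K A c)) * x α v ^ j +
          coeff α v a * y α v ^ i * (casimir α v (u : A) - coeff α v (algebraMap K A c)) *
            x α v ^ j := by rw [e]; noncomm_ring
      _ = _ := by
        rw [coeff_mul_pow_y, ← mul_assoc, ← map_mul, h, ← (commute_casimir_sub hv c _).eq, mul_add,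
          add_assoc]
        simp only [mul_assoc]

/-- Modulo `z - c` every element is congruent to a combination of the powers of `y` and `x`. -/
theorem exists_normal_form (hv : (v : A) = (u : A) - α (u : A)) (c : K) (f : AmbiskewRing α v) :
    ∃ (p : ℤ →₀ A) (r : AmbiskewRing α v), f = (p.sum fun n b => coeff α v b * zpowYX α v n) +
      (casimir α v (u : A) - coeff α v (algebraMap K A c)) * r := by
  induction f using induction_on with
  | hadd f g hf hg =>
    obtain ⟨p, r, rfl⟩ := hf
    obtain ⟨q, s, rfl⟩ := hg
    refine ⟨p + q, r + s, ?_⟩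
    rw [Finsupp.sum_add_index' (by simp) (by simp [add_mul]), mul_add]
    abel
  | hm a i j =>
    obtain ⟨n, b, r, h⟩ := exists_monomial_eq hv c i j a
    exact ⟨Finsupp.single n b, r, by rw [h, Finsupp.sum_single_index (by simp)]⟩

end AmbiskewRing

/-! ### Constants and the unit `y` in the skew Laurent ring. -/

namespace SkewLaurent

variable {α : A ≃ₐ[K] A}

/-- The inclusion `A → A[y^{±1}; α]`. -/
noncomputable def constHom (α : A ≃ₐ[K] A) : A →+* SkewLaurent α where
  toFun := const α
  map_one' := rfl
  map_zero' := mono_zero 0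
  map_add' := mono_add 0
  map_mul' a b := by
    change mono α 0 (a * b) = mono α 0 a * mono α 0 b
    rw [mono_mul_mono, add_zero, zpow_zero, AlgEquiv.one_apply]

theorem constHom_apply (a : A) : constHom α a = mono α 0 a :=
  rfl

/-- The unit `y` of `A[y^{±1}; α]`. -/
noncomputable def unitY (α : A ≃ₐ[K] A) : (SkewLaurent α)ˣ where
  val := mono α 1 1
  inv := mono α (-1) 1
  val_inv := by rw [mono_mul_mono, map_one, mul_one, add_neg_cancel, mono_one]
  inv_val := by rw [mono_mul_mono, map_one, mul_one, neg_add_cancel, mono_one]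

theorem unitY_mul (a : A) : unitY α * constHom α a = constHom α (α a) * unitY α := by
  change mono α 1 1 * mono α 0 a = mono α 0 (α a) * mono α 1 1
  rw [mono_mul_mono, mono_mul_mono, map_one, mul_one, one_mul, add_zero, zero_add, zpow_one]

theorem unitY_pow (n : ℕ) : (unitY α : SkewLaurent α) ^ n = mono α n 1 := by
  induction n with
  | zero => rfl
  | succ n ih =>
    rw [pow_succ, ih]
    change mono α n 1 * mono α 1 1 = _
    rw [mono_mul_mono, map_one, mul_one, Nat.cast_succ]

theorem constHom_algebraMap_comm (c : K) (f : SkewLaurent α) :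
    constHom α (algebraMap K A c) * f = f * constHom α (algebraMap K A c) := by
  induction f using induction_on with
  | h0 => simp
  | hadd f g hf hg => rw [mul_add, hf, hg, add_mul]
  | hm n a =>
    rw [constHom_apply, mono_mul_mono, mono_mul_mono, AlgEquiv.commutes, add_zero, zero_add,
      zpow_zero, AlgEquiv.one_apply, Algebra.commutes]

end SkewLaurent

/-! ### The maps `R → L` and `R → L[z]`, and their kernels. -/

namespace AmbiskewRing

variable {α : A ≃ₐ[K] A} {u v : Subring.center A} (hv : (v : A) = (u : A) - α (u : A))

/-- The homomorphism `R(A, α, v, 1) → A[y^{±1}; α]` that sends the Casimir element to `c`. -/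
noncomputable def toLaurent (c : K) : AmbiskewRing α v →+* SkewLaurent α :=
  lift hv (Y := SkewLaurent.unitY α) SkewLaurent.unitY_mul (SkewLaurent.constHom_algebraMap_comm c)

/-- The image of `x` is `(c + u) y⁻¹`, and `c + u ≠ 0` because `u ∉ K`. In a domain the coefficients
of its powers stay nonzero. -/
theorem toLaurent_zpowYX [IsDomain A] (hu : (u : A) ∉ Set.range (algebraMap K A)) (c : K) (n : ℤ) :
    ∃ b : A, b ≠ 0 ∧ toLaurent hv c (zpowYX α v n) = SkewLaurent.mono α n b := by
  obtain ⟨n, rfl | rfl⟩ := n.eq_nat_or_neg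
  · refine ⟨1, one_ne_zero, ?_⟩
    change toLaurent hv c (y α v ^ n) = _
    rw [map_pow, toLaurent, lift_y, SkewLaurent.unitY_pow]
  · rw [zpowYX_neg, map_pow]
    have hx : toLaurent hv c (x α v) = SkewLaurent.mono α (-1) (algebraMap K A c + u) := by
      rw [toLaurent, lift_x, ← map_add]
      change SkewLaurent.mono α 0 _ * SkewLaurent.mono α (-1) 1 = _
      rw [SkewLaurent.mono_mul_mono, map_one, mul_one, zero_add]
    have hcu : algebraMap K A c + u ≠ 0 := fun h =>
      hu ⟨-c, by rw [map_neg]; exact (eq_neg_of_add_eq_zero_right h).symm⟩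
    induction n with
    | zero => exact ⟨1, one_ne_zero, rfl⟩
    | succ n ih =>
      obtain ⟨b, hb, h⟩ := ih
      refine ⟨(algebraMap K A c + u) * (α ^ (-1 : ℤ)) b,
        mul_ne_zero hcu ((map_ne_zero_iff _ (α ^ (-1 : ℤ)).injective).2 hb), ?_⟩
      rw [pow_succ', h, hx, SkewLaurent.mono_mul_mono, Nat.cast_succ, neg_add_rev]

/-- The powers of `y` and `x` in a normal form map to distinct degrees with nonzero coefficients.
Thus a normal form that maps to zero has all coefficients zero, and only its multiple of `z - c`
remains. -/
theorem toLaurent_eq_zero_iff [IsDomain A] (hu : (u : A) ∉ Set.range (algebraMap K A)) (c : K)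
    (f : AmbiskewRing α v) : toLaurent hv c f = 0 ↔
      ∃ r, f = (casimir α v (u : A) - coeff α v (algebraMap K A c)) * r := by
  have hz : toLaurent hv c (casimir α v (u : A) - coeff α v (algebraMap K A c)) = 0 := by
    rw [map_sub, toLaurent, lift_casimir, lift_coeff, sub_self]
  constructor
  · intro h
    obtain ⟨p, r, rfl⟩ := exists_normal_form hv c f
    choose b hb hφ using toLaurent_zpowYX hv hu c
    rw [map_add, map_mul, hz, zero_mul, add_zero, Finsupp.sum, map_sum] at h
    have hterm : ∀ n, toLaurent hv c (coeff α v (p n) * zpowYX α v n) =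
        SkewLaurent.mono α n (p n * b n) := fun n => by
      rw [map_mul, hφ, toLaurent, lift_coeff, SkewLaurent.constHom_apply,
        SkewLaurent.mono_mul_mono, zero_add, zpow_zero, AlgEquiv.one_apply]
    have hp : p = 0 := by
      ext n
      by_contra hn
      have h' := DFunLike.congr_fun (congrArg (SkewLaurent.coeffs α) h) n
      rw [map_zero, map_sum, Finsupp.finsetSum_apply, Finset.sum_eq_single n, hterm,
        SkewLaurent.coeffs_mono, Finsupp.single_eq_same] at h'
      · exact mul_ne_zero hn (hb n) h'
      · intro m _ hmn
        rw [hterm, SkewLaurent.coeffs_mono, Finsupp.single_eq_of_ne hmn.symm]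
      · exact fun h0 => absurd (Finsupp.notMem_support_iff.1 h0) hn
    exact ⟨r, by rw [hp, Finsupp.sum_zero_index, zero_add]⟩
  · rintro ⟨r, rfl⟩
    rw [map_mul, hz, zero_mul]

/-- The embedding `R(A, α, v, 1) → A[y^{±1}; α][z]`. -/
noncomputable def toLaurentPoly : AmbiskewRing α v →+* Polynomial (SkewLaurent α) :=
  lift hv (f := Polynomial.C.comp (SkewLaurent.constHom α))
    (Y := Units.map (Polynomial.C : SkewLaurent α →+* _) (SkewLaurent.unitY α))
    (fun a => by
      change Polynomial.C _ * Polynomial.C _ = Polynomial.C _ * Polynomial.C _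
      rw [← Polynomial.C_mul, ← Polynomial.C_mul]
      exact congrArg _ (SkewLaurent.unitY_mul a))
    (w := Polynomial.X) (fun _ => Polynomial.X_mul)

theorem toLaurentPoly_coeff (a : A) :
    toLaurentPoly hv (coeff α v a) = Polynomial.C (SkewLaurent.constHom α a) :=
  lift_coeff _ _ _ _

theorem toLaurentPoly_y :
    toLaurentPoly hv (y α v) = Polynomial.C (SkewLaurent.unitY α : SkewLaurent α) :=
  lift_y _ _ _

theorem toLaurentPoly_casimir :
    toLaurentPoly hv (casimir α v (u : A)) = Polynomial.X :=
  lift_casimir _ _ _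

theorem constantCoeff_toLaurentPoly (f : AmbiskewRing α v) :
    Polynomial.constantCoeff (toLaurentPoly hv f) = toLaurent hv 0 f := by
  refine DFunLike.congr_fun (f := Polynomial.constantCoeff.comp (toLaurentPoly hv))
    (ringHom_ext (fun a => ?_) ?_ ?_) f
  · rw [RingHom.comp_apply, toLaurentPoly_coeff, toLaurent, lift_coeff]
    exact Polynomial.coeff_C_zero
  · rw [RingHom.comp_apply, toLaurentPoly_y, toLaurent, lift_y]
    exact Polynomial.coeff_C_zero
  · rw [RingHom.comp_apply, toLaurentPoly, toLaurent, lift_x, lift_x, map_mul, map_add, map_zero,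
      map_zero]
    congr 1
    · congr 1
      · exact Polynomial.coeff_X_zero
      · exact Polynomial.coeff_C_zero
    · exact Polynomial.coeff_C_zero

/-- A subset whose elements are divisible by `z - c` within the subset is zero. -/
theorem eq_zero_of_forall_exists_casimir_mul [IsDomain A] (c : K) (S : Set (AmbiskewRing α v))
    (hS : ∀ f ∈ S, ∃ g ∈ S, f = (casimir α v (u : A) - coeff α v (algebraMap K A c)) * g)
    {f : AmbiskewRing α v} (hf : f ∈ S) : f = 0 := by
  have := SkewPolyRing.isDomain α
  -- Since `z - c = yx + (v - u - c)`, its degree in `x` is one and its leading coefficient is `y`.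
  have e : casimir α v (u : A) - coeff α v (algebraMap K A c) =
      OreExtension.monomial _ _ 1 (OreExtension.X _ _) +
        OreExtension.C _ _ (OreExtension.C _ _ ((v : A) - u - algebraMap K A c)) := by
    have h1 : OreExtension.monomial _ _ 1 (OreExtension.X _ _) = y α v * x α v := by
      rw [OreExtension.monomial_eq, pow_one]; rfl
    have h2 : OreExtension.C _ _ (OreExtension.C _ _ ((v : A) - u - algebraMap K A c)) =
      coeff α v ((v : A) - u - algebraMap K A c) := rfl
    rw [h1, h2, casimir, x_mul_y, map_sub, map_sub]
    abel
  refine OreExtension.eq_zero_of_forall_exists_mul (SkewPolyRing.beta_injective α) (m := 1)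
    (c := OreExtension.X _ _) ?_ ?_ one_pos S hS hf
  · rw [e]
    have key : ∀ b d : SkewPolyRing α,
        OreExtension.HasTop (Finsupp.single 1 b + Finsupp.single 0 d) 1 b := by
      intro b d
      refine ⟨by simp, fun k hk => ?_⟩
      rw [Finsupp.add_apply, Finsupp.single_eq_of_ne (by omega),
        Finsupp.single_eq_of_ne (by omega), add_zero]
    exact key _ _
  · intro h
    have := DFunLike.congr_fun (show Finsupp.single 1 (1 : A) = 0 from h) 1
    simp at this

/-- The constant coefficient of the image is the specialisation at `z = 0`, so a kernel element is
`z r`. As the polynomial variable is cancellable, `r` is again in the kernel, which is therefore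
infinitely divisible by `z`. -/
theorem toLaurentPoly_injective [IsDomain A] (hu : (u : A) ∉ Set.range (algebraMap K A)) :
    Function.Injective (toLaurentPoly hv) := by
  rw [injective_iff_map_eq_zero]
  intro f hf
  refine eq_zero_of_forall_exists_casimir_mul (u := u) 0 {f | toLaurentPoly hv f = 0} ?_ hf
  intro f (hf : toLaurentPoly hv f = 0)
  have h0 : toLaurent hv 0 f = 0 := by
    rw [← constantCoeff_toLaurentPoly, hf, map_zero]
  obtain ⟨r, rfl⟩ := (toLaurent_eq_zero_iff hv hu 0 f).1 h0
  refine ⟨r, show toLaurentPoly hv r = 0 from ?_, rfl⟩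
  rw [map_mul, map_sub, toLaurentPoly_casimir, toLaurentPoly_coeff, map_zero,
    map_zero, map_zero, sub_zero] at hf
  rw [Polynomial.X_mul] at hf
  exact Polynomial.monic_X.mul_left_eq_zero_iff.1 hf

end AmbiskewRing

end Ambiskew

/-! ### Ideals of polynomial rings over simple rings. -/

/-- A nonzero ideal of `L[X]`, for a simple ring `L`, contains a nonzero polynomial with central
coefficients. -/
theorem TwoSidedIdeal.exists_ne_zero_coeff_mem_center {L : Type*} [Ring L] [IsSimpleRing L]
    (J : TwoSidedIdeal (Polynomial L)) {g : Polynomial L} (hg : g ∈ J) (hg0 : g ≠ 0) :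
    ∃ f ∈ J, f ≠ 0 ∧ ∀ i, f.coeff i ∈ Subring.center L := by
  classical
  have hex : ∃ n, ∃ f ∈ J, f ≠ 0 ∧ f.natDegree = n := ⟨_, g, hg, hg0, rfl⟩
  obtain ⟨f₀, hf₀, hf₀0, hf₀n⟩ := Nat.find_spec hex
  have hmin : ∀ f ∈ J, f ≠ 0 → Nat.find hex ≤ f.natDegree := fun f hf h0 =>
    Nat.find_min' hex ⟨f, hf, h0, rfl⟩
  set n := Nat.find hex
  -- With `n` the least degree of a nonzero element of `J`, the coefficients of degree `n` form a
  -- nonzero ideal of `L`; simplicity then yields an element of `J` with top coefficient `1`.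
  let I : TwoSidedIdeal L := TwoSidedIdeal.mk' {c | ∃ f ∈ J, f.natDegree ≤ n ∧ f.coeff n = c}
    ⟨0, J.zero_mem, by simp, by simp⟩
    (by
      rintro _ _ ⟨f, hf, hfn, rfl⟩ ⟨f', hf', hfn', rfl⟩
      exact ⟨f + f', J.add_mem hf hf', (Polynomial.natDegree_add_le _ _).trans (max_le hfn hfn'),
        Polynomial.coeff_add _ _ _⟩)
    (by
      rintro _ ⟨f, hf, hfn, rfl⟩
      exact ⟨-f, J.neg_mem hf, by rwa [Polynomial.natDegree_neg], Polynomial.coeff_neg _ _⟩)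
    (by
      rintro a _ ⟨f, hf, hfn, rfl⟩
      exact ⟨Polynomial.C a * f, J.mul_mem_left _ _ hf,
        (Polynomial.natDegree_C_mul_le _ _).trans hfn,
        Polynomial.coeff_C_mul _⟩)
    (by
      rintro _ a ⟨f, hf, hfn, rfl⟩
      exact ⟨f * Polynomial.C a, J.mul_mem_right _ _ hf,
        (Polynomial.natDegree_mul_C_le _ _).trans hfn,
        Polynomial.coeff_mul_C _ _ _⟩)
  have hI : ∀ c, c ∈ I ↔ ∃ f ∈ J, f.natDegree ≤ n ∧ f.coeff n = c := fun c =>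
    TwoSidedIdeal.mem_mk' _ _ _ _ _ _ c
  have hne : I ≠ ⊥ := by
    intro h
    have hm : f₀.coeff n ∈ I := (hI _).2 ⟨f₀, hf₀, hf₀n.le, rfl⟩
    rw [h, TwoSidedIdeal.mem_bot, ← hf₀n, Polynomial.coeff_natDegree,
      Polynomial.leadingCoeff_eq_zero] at hm
    exact hf₀0 hm
  have h1 : (1 : L) ∈ I := by
    rw [(IsSimpleOrder.eq_bot_or_eq_top I).resolve_left hne]
    trivial
  obtain ⟨f, hf, hfn, hf1⟩ := (hI 1).1 h1
  have : Nontrivial L := by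
    by_contra h
    rw [not_nontrivial_iff_subsingleton] at h
    exact hg0 (Subsingleton.elim _ _)
  refine ⟨f, hf, ?_, fun i => Subring.mem_center_iff.2 fun l => ?_⟩
  · rintro rfl
    simp at hf1
  -- Because `f` is monic of degree `n`, its commutator with a constant lies in `J` and has zero
  -- coefficient at `n`; minimality of `n` makes it vanish.
  have hz : Polynomial.C l * f - f * Polynomial.C l = 0 := by
    by_contra h0
    have hmem : Polynomial.C l * f - f * Polynomial.C l ∈ J :=
      J.sub_mem (J.mul_mem_left _ _ hf) (J.mul_mem_right _ _ hf)
    have hle : (Polynomial.C l * f - f * Polynomial.C l).natDegree ≤ n :=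
      (Polynomial.natDegree_sub_le _ _).trans (max_le
        ((Polynomial.natDegree_C_mul_le _ _).trans hfn) ((Polynomial.natDegree_mul_C_le _ _).trans hfn))
    have hc : (Polynomial.C l * f - f * Polynomial.C l).coeff n = 0 := by
      rw [Polynomial.coeff_sub, Polynomial.coeff_C_mul, Polynomial.coeff_mul_C, hf1, mul_one,
        one_mul, sub_self]
    have heq := le_antisymm hle (hmin _ hmem h0)
    rw [← heq, Polynomial.coeff_natDegree, Polynomial.leadingCoeff_eq_zero] at hc
    exact h0 hc
  have := congrArg (fun q => Polynomial.coeff q i) hz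
  simpa [sub_eq_zero] using this

/-! ### Extending ideals of `R` by inverting `y`. -/

section Ambiskew

variable {K A : Type*} [Field K] [Ring A] [Algebra K A]

namespace SkewLaurent

variable {α : A ≃ₐ[K] A}

/-- Clearing denominators: `j.toNat` and `(-j).toNat` are the positive and negative parts of `j`. An
extra left factor `y` to the power `(-j).toNat` lets `a yʲ` pass a left denominator `yⁿ` and become
an element of the image of `R`. This makes `localizedSet` absorb multiplication on the left. -/
theorem unitY_pow_mul_mono (n : ℕ) (j : ℤ) (a : A) :
    (unitY α : SkewLaurent α) ^ (n + (-j).toNat) * mono α j a =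
      (unitY α : SkewLaurent α) ^ j.toNat * constHom α ((α ^ (n + (-j).toNat - j.toNat : ℤ)) a) *
        (unitY α : SkewLaurent α) ^ n := by
  rw [unitY_pow, unitY_pow, unitY_pow, constHom_apply, mono_mul_mono, mono_mul_mono, mono_mul_mono]
  simp only [map_one, mul_one, one_mul, ← AlgEquiv.mul_apply, ← zpow_add]
  have e : (j.toNat : ℤ) + (n + (-j).toNat - j.toNat) = (n + (-j).toNat : ℕ) := by
    push_cast
    ring
  rw [e]
  congr 1
  push_cast
  omega

/-- The mirror image, for absorption on the right. -/
theorem mono_mul_unitY_pow (n : ℕ) (j : ℤ) (a : A) :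
    mono α j a * (unitY α : SkewLaurent α) ^ (n + (-j).toNat) =
      (unitY α : SkewLaurent α) ^ n * (constHom α ((α ^ (-n : ℤ)) a) *
        (unitY α : SkewLaurent α) ^ j.toNat) := by
  rw [unitY_pow, unitY_pow, unitY_pow, constHom_apply, mono_mul_mono, mono_mul_mono, mono_mul_mono]
  simp only [map_one, mul_one, one_mul, ← AlgEquiv.mul_apply, ← zpow_add, add_neg_cancel,
    zpow_zero, AlgEquiv.one_apply]
  congr 1
  push_cast
  omega

instance [Nontrivial A] : Nontrivial (SkewLaurent α) :=
  inferInstanceAs (Nontrivial (SkewMonoidAlgebra A (Multiplicative ℤ)))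

end SkewLaurent

namespace AmbiskewRing

open SkewLaurent Polynomial

variable {α : A ≃ₐ[K] A} {u v : Subring.center A} (hv : (v : A) = (u : A) - α (u : A))

theorem toLaurentPoly_pow_y (n : ℕ) :
    toLaurentPoly hv (y α v ^ n) = C (unitY α : SkewLaurent α) ^ n := by
  rw [map_pow, toLaurentPoly_y]

/-- The elements of `A[y^{±1}; α][z]` that lie in the ideal `I` of `R(A, α, v, 1)` after
multiplication by powers of `y` on both sides. -/
def localizedSet (I : TwoSidedIdeal (AmbiskewRing α v)) : Set (SkewLaurent α)[X] :=
  {t | ∃ n m : ℕ, ∃ i ∈ I, toLaurentPoly hv i =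
    C (unitY α : SkewLaurent α) ^ n * t * C (unitY α : SkewLaurent α) ^ m}

variable {hv} {I : TwoSidedIdeal (AmbiskewRing α v)}

theorem add_mem_localizedSet {s t : (SkewLaurent α)[X]} (hs : s ∈ localizedSet hv I)
    (ht : t ∈ localizedSet hv I) : s + t ∈ localizedSet hv I := by
  obtain ⟨n, m, i, hi, h⟩ := hs
  obtain ⟨n', m', i', hi', h'⟩ := ht
  -- Common denominators on both sides: each numerator is multiplied by the powers of `y` belonging
  -- to the other.
  refine ⟨n + n', m + m', y α v ^ n' * i * y α v ^ m' + y α v ^ n * i' * y α v ^ m,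
    I.add_mem (I.mul_mem_right _ _ (I.mul_mem_left _ _ hi))
      (I.mul_mem_right _ _ (I.mul_mem_left _ _ hi')), ?_⟩
  have key : ∀ (k l a b : ℕ) (f r : (SkewLaurent α)[X]), f ^ a * (f ^ k * r * f ^ l) * f ^ b =
      f ^ (k + a) * r * f ^ (l + b) := fun k l a b f r => by
    rw [pow_add, pow_add, (Commute.pow_pow_self f k a).eq]
    simp only [mul_assoc]
  rw [map_add, map_mul, map_mul, map_mul, map_mul, h, h', mul_add, add_mul, toLaurentPoly_pow_y,
    toLaurentPoly_pow_y, toLaurentPoly_pow_y, toLaurentPoly_pow_y, key, key, add_comm n',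
    add_comm m']

theorem zero_mem_localizedSet : 0 ∈ localizedSet hv I :=
  ⟨0, 0, 0, I.zero_mem, by rw [map_zero, mul_zero, zero_mul]⟩

theorem neg_mem_localizedSet {t : (SkewLaurent α)[X]} (ht : t ∈ localizedSet hv I) :
    -t ∈ localizedSet hv I := by
  obtain ⟨n, m, i, hi, h⟩ := ht
  exact ⟨n, m, -i, I.neg_mem hi, by rw [map_neg, h, mul_neg, neg_mul]⟩

theorem mul_mem_localizedSet_left {s t : (SkewLaurent α)[X]} (ht : t ∈ localizedSet hv I) :
    s * t ∈ localizedSet hv I := by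
  induction s using Polynomial.induction_on' with
  | add s s' hs hs' => rw [add_mul]; exact add_mem_localizedSet hs hs'
  | monomial k l =>
    induction l using SkewLaurent.induction_on with
    | h0 => rw [monomial_zero_right, zero_mul]; exact zero_mem_localizedSet
    | hadd l l' hl hl' => rw [map_add, add_mul]; exact add_mem_localizedSet hl hl'
    | hm j a =>
      obtain ⟨n, m, i, hi, h⟩ := ht
      refine ⟨n + (-j).toNat, m, casimir α v (u : A) ^ k * y α v ^ j.toNat *
        coeff α v ((α ^ (n + (-j).toNat - j.toNat : ℤ)) a) * i, I.mul_mem_left _ _ hi, ?_⟩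
      have hC := congrArg C (unitY_pow_mul_mono (α := α) n j a)
      rw [C_mul, C_mul, C_mul, C_pow, C_pow, C_pow] at hC
      have hz : toLaurentPoly hv (casimir α v (u : A) ^ k) = X ^ k := by
        rw [map_pow, toLaurentPoly_casimir]
      rw [map_mul, map_mul, map_mul, h, toLaurentPoly_pow_y, toLaurentPoly_coeff, hz,
        ← C_mul_X_pow_eq_monomial, ← X_pow_mul, ← mul_assoc (_ ^ (n + _)),
        ← mul_assoc (_ ^ (n + _)), ← X_pow_mul, mul_assoc (X ^ k) (_ ^ _) (C (mono α j a)), hC]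
      simp only [mul_assoc]

theorem mul_mem_localizedSet_right {s t : (SkewLaurent α)[X]} (hs : s ∈ localizedSet hv I) :
    s * t ∈ localizedSet hv I := by
  induction t using Polynomial.induction_on' with
  | add t t' ht ht' => rw [mul_add]; exact add_mem_localizedSet ht ht'
  | monomial k l =>
    induction l using SkewLaurent.induction_on with
    | h0 => rw [monomial_zero_right, mul_zero]; exact zero_mem_localizedSet
    | hadd l l' hl hl' => rw [map_add, mul_add]; exact add_mem_localizedSet hl hl'
    | hm j a =>
      obtain ⟨n, m, i, hi, h⟩ := hs
      refine ⟨n, m + (-j).toNat, i * (coeff α v ((α ^ (-m : ℤ)) a) * y α v ^ j.toNat *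
        casimir α v (u : A) ^ k), I.mul_mem_right _ _ hi, ?_⟩
      have hC := congrArg C (mono_mul_unitY_pow (α := α) m j a)
      rw [C_mul, C_mul, C_mul, C_pow, C_pow, C_pow] at hC
      have hz : toLaurentPoly hv (casimir α v (u : A) ^ k) = X ^ k := by
        rw [map_pow, toLaurentPoly_casimir]
      rw [map_mul, map_mul, map_mul, h, toLaurentPoly_pow_y, toLaurentPoly_coeff, hz,
        ← C_mul_X_pow_eq_monomial]
      simp only [mul_assoc, X_pow_mul]
      rw [← mul_assoc (C (mono α j a)), hC]
      simp only [mul_assoc]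

/-- The ideal of `A[y^{±1}; α][z]` generated by the ideal `I` of `R(A, α, v, 1)`. -/
noncomputable def localizedIdeal (hv : (v : A) = (u : A) - α (u : A))
    (I : TwoSidedIdeal (AmbiskewRing α v)) :
    TwoSidedIdeal (SkewLaurent α)[X] :=
  TwoSidedIdeal.mk' (localizedSet hv I) zero_mem_localizedSet add_mem_localizedSet
    neg_mem_localizedSet mul_mem_localizedSet_left mul_mem_localizedSet_right

theorem mem_localizedIdeal {t : (SkewLaurent α)[X]} :
    t ∈ localizedIdeal hv I ↔ t ∈ localizedSet hv I :=
  TwoSidedIdeal.mem_mk' _ _ _ _ _ _ t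

/-! ### Polynomials in the Casimir element and the primes that contain them. -/

variable (α u v) in
/-- Evaluation of polynomials over `K` at the Casimir element. -/
noncomputable def evalCasimir : K[X] →+* AmbiskewRing α v :=
  eval₂RingHom' ((coeff α v).comp (algebraMap K A)) (casimir α v (u : A)) fun c =>
    commute_algebraMap c _

theorem evalCasimir_C (c : K) : evalCasimir α u v (C c) = coeff α v (algebraMap K A c) :=
  eval₂_C _ _

theorem evalCasimir_X : evalCasimir α u v X = casimir α v (u : A) :=
  eval₂_X _ _

variable (hv)
include hv

theorem commute_evalCasimir (p : K[X]) (r : AmbiskewRing α v) :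
    Commute (evalCasimir α u v p) r := by
  induction p using Polynomial.induction_on with
  | C c => rw [evalCasimir_C]; exact commute_algebraMap c r
  | add p q hp hq => rw [map_add]; exact hp.add_left hq
  | monomial n c _ =>
    rw [map_mul, map_pow, evalCasimir_C, evalCasimir_X]
    exact (commute_algebraMap c r).mul_left ((commute_casimir hv r).pow_left _)

theorem toLaurentPoly_evalCasimir (p : K[X]) : toLaurentPoly hv (evalCasimir α u v p) =
    p.map ((constHom α).comp (algebraMap K A)) := by
  induction p using Polynomial.induction_on with
  | C c => rw [evalCasimir_C, toLaurentPoly_coeff, map_C, RingHom.comp_apply]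
  | add p q hp hq => rw [map_add, map_add, hp, hq, Polynomial.map_add]
  | monomial n c _ =>
    rw [map_mul, map_pow, evalCasimir_C, evalCasimir_X, map_mul, map_pow, toLaurentPoly_casimir,
      toLaurentPoly_coeff, Polynomial.map_mul, Polynomial.map_pow, map_C, map_X,
      RingHom.comp_apply]

/-- A nonzero ideal of `R(A, α, v, 1)` contains the product of a power of `y` and a nonzero
polynomial in the Casimir element. -/
theorem exists_evalCasimir_mul_pow_mem [IsDomain A] (hu : (u : A) ∉ Set.range (algebraMap K A))
    (hsimple : IsSimpleRing (SkewLaurent α))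
    (hcenter : (Subring.center (SkewLaurent α) : Set (SkewLaurent α)) =
      Set.range fun c : K => SkewLaurent.const α (algebraMap K A c))
    (hI : I ≠ ⊥) : ∃ p : K[X], p ≠ 0 ∧ ∃ n : ℕ, evalCasimir α u v p * y α v ^ n ∈ I := by
  have hinj := toLaurentPoly_injective hv hu
  obtain ⟨i, hi, hi0⟩ : ∃ i ∈ I, i ≠ 0 := by
    by_contra! h
    exact hI (le_bot_iff.1 fun i hi => (TwoSidedIdeal.mem_bot _).2 (h i hi))
  have hmem : toLaurentPoly hv i ∈ localizedIdeal hv I :=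
    mem_localizedIdeal.2 ⟨0, 0, i, hi, by rw [pow_zero, one_mul, mul_one]⟩
  obtain ⟨f, hf, hf0, hfc⟩ := (localizedIdeal hv I).exists_ne_zero_coeff_mem_center hmem
    ((map_ne_zero_iff _ hinj).2 hi0)
  -- Central coefficients are scalars, so `f` comes from `K[z]`.
  obtain ⟨p, rfl⟩ : ∃ p : K[X], p.map ((constHom α).comp (algebraMap K A)) = f := by
    rw [← mem_lifts, lifts_iff_coeff_lifts]
    intro k
    obtain ⟨c, hc⟩ : f.coeff k ∈ Set.range fun c : K => SkewLaurent.const α (algebraMap K A c) :=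
      hcenter ▸ hfc k
    exact ⟨c, hc⟩
  obtain ⟨n, m, j, hj, h⟩ := mem_localizedIdeal.1 hf
  refine ⟨p, fun h0 => hf0 (by rw [h0, Polynomial.map_zero]), n + m, ?_⟩
  -- As `p(z)` is central, the powers of `y` on its two sides collect on the right; injectivity
  -- carries the identity back to `R`.
  have : j = evalCasimir α u v p * y α v ^ (n + m) := by
    apply hinj
    rw [h, pow_add, ← mul_assoc, (commute_evalCasimir hv p _).eq, map_mul, map_mul,
      toLaurentPoly_pow_y, toLaurentPoly_pow_y, toLaurentPoly_evalCasimir]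
  exact this ▸ hj

variable {P : TwoSidedIdeal (AmbiskewRing α v)}

/-- Centrality of `z - c` gives `(z - c) R t ⊆ P`, to which primeness applies. -/
theorem casimir_sub_mem_or_mem (hP : IsPrimeIdeal P) {c : K} {t : AmbiskewRing α v}
    (h : (casimir α v (u : A) - coeff α v (algebraMap K A c)) * t ∈ P) :
    casimir α v (u : A) - coeff α v (algebraMap K A c) ∈ P ∨ t ∈ P := by
  refine hP.2 _ _ fun r => ?_
  rw [(commute_casimir_sub hv c r).eq, mul_assoc]
  exact P.mul_mem_left _ _ h

/-- Over an algebraically closed field linear factors can be split off `p` one at a time. Either one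
of them lies in `P` or all are removed, leaving an invertible constant times `t`. -/
theorem exists_casimir_sub_mem_or_mem [IsAlgClosed K] (hP : IsPrimeIdeal P) {p : K[X]} (hp : p ≠ 0)
    {t : AmbiskewRing α v} (h : evalCasimir α u v p * t ∈ P) :
    (∃ c : K, casimir α v (u : A) - coeff α v (algebraMap K A c) ∈ P) ∨ t ∈ P := by
  induction hn : p.natDegree generalizing p with
  | zero =>
    right
    rw [eq_C_of_natDegree_eq_zero hn] at h hp
    have hc : p.coeff 0 ≠ 0 := fun h0 => hp (by rw [h0, C_0])
    have h' := P.mul_mem_left (evalCasimir α u v (C (p.coeff 0)⁻¹)) _ h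
    rwa [← mul_assoc, ← map_mul, ← C_mul, inv_mul_cancel₀ hc, C_1, map_one, one_mul] at h'
  | succ n ih =>
    obtain ⟨c, hc⟩ := IsAlgClosed.exists_root p
      (fun h0 => by have := natDegree_eq_of_degree_eq_some (n := 0) h0; omega)
    obtain ⟨q, rfl⟩ := dvd_iff_isRoot.2 hc
    have hq : q ≠ 0 := right_ne_zero_of_mul hp
    rw [map_mul, map_sub, evalCasimir_X, evalCasimir_C, mul_assoc] at h
    rcases casimir_sub_mem_or_mem hv hP h with h | h
    · exact Or.inl ⟨c, h⟩
    · refine ih hq h ?_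
      rw [natDegree_mul (X_sub_C_ne_zero c) hq, natDegree_X_sub_C] at hn
      omega

/-- Here `x yⁿ⁺¹ = (z + u) yⁿ` and `yⁿ⁺¹ x = (z + αⁿ⁺¹(u)) yⁿ`, so the difference telescopes to
`v⁽ⁿ⁺¹⁾ yⁿ`. -/
theorem x_mul_pow_y (n : ℕ) : x α v * y α v ^ (n + 1) =
    y α v ^ (n + 1) * x α v + coeff α v (iterV α v (n + 1)) * y α v ^ n := by
  rw [pow_succ', ← mul_assoc, x_mul_y_eq (u : A), ← pow_succ', pow_succ, mul_assoc,
    y_mul_x_eq hv, mul_add, ← (commute_casimir hv _).eq, coeff_mul_pow_y, iterV_eq_sub α hv,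
    map_sub, add_mul, sub_mul, pow_succ α, AlgEquiv.mul_apply]
  abel

/-- Modulo an ideal that contains `yⁿ⁺¹`, the element `u` acts on `yⁿ` as `-z`. -/
theorem coeff_aeval_mul_pow_sub_mem {n : ℕ} (h : y α v ^ (n + 1) ∈ I) (p : K[X]) :
    coeff α v (aeval (u : A) p) * y α v ^ n - evalCasimir α u v (p.comp (-X)) * y α v ^ n ∈ I := by
  have hu : coeff α v u * y α v ^ n - evalCasimir α u v (-X) * y α v ^ n ∈ I := by
    -- This is `(u + z) yⁿ = (xy) yⁿ`.
    have : coeff α v u * y α v ^ n - evalCasimir α u v (-X) * y α v ^ n =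
        x α v * y α v ^ (n + 1) := by
      rw [map_neg, evalCasimir_X, pow_succ', ← mul_assoc, x_mul_y_eq (u : A)]
      noncomm_ring
    rw [this]
    exact I.mul_mem_left _ _ h
  induction p using Polynomial.induction_on with
  | C c => rw [aeval_C, C_comp, evalCasimir_C, sub_self]; exact I.zero_mem
  | add p q hp hq =>
    have := I.add_mem hp hq
    rw [sub_add_sub_comm, ← add_mul, ← add_mul, ← map_add, ← map_add, ← map_add, ← add_comp] at this
    exact this
  | monomial k c ih =>
    rw [pow_succ', ← mul_assoc, mul_comm (C c), mul_assoc]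
    set q := C c * X ^ k
    rw [map_mul, aeval_X, map_mul, mul_comp, X_comp]
    -- The difference for `X q` is `u (q(u) - q(-z)) yⁿ + q(-z)(u + z) yⁿ`.
    have := I.add_mem (I.mul_mem_left (coeff α v u) _ ih)
      (I.mul_mem_left (evalCasimir α u v (q.comp (-X))) _ hu)
    rw [mul_sub, mul_sub, ← mul_assoc, ← mul_assoc, ← mul_assoc, ← mul_assoc,
      ← (commute_evalCasimir hv (q.comp (-X)) (coeff α v u)).eq, sub_add_sub_cancel, ← map_mul,
      ← map_mul, mul_comm (q.comp (-X)), map_mul (coeff α v)] at this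
    exact this

/-- Descent on `n`. If `yⁿ⁺¹ ∈ P`, commuting with `x` gives `v⁽ⁿ⁺¹⁾ yⁿ ∈ P`, hence `p(u) yⁿ ∈ P`.
Modulo `P` this is `p(-z) yⁿ`, so either some `z - c` or `yⁿ` lies in `P`. At `n = 0` the prime
would contain `1`. -/
theorem exists_casimir_sub_mem_of_pow_mem [IsAlgClosed K]
    (hpoly : ∀ m : ℕ, 1 ≤ m → ∃ p : Polynomial K, p ≠ 0 ∧
      ∃ a : A, Polynomial.aeval (u : A) p = iterV α (v : A) m * a)
    (hP : IsPrimeIdeal P) (n : ℕ) (h : y α v ^ n ∈ P) :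
    ∃ c : K, casimir α v (u : A) - coeff α v (algebraMap K A c) ∈ P := by
  induction n with
  | zero => exact absurd (P.one_mem_iff.1 (by simpa using h)) hP.1
  | succ n ih =>
    obtain ⟨p, hp, a, ha⟩ := hpoly (n + 1) (by omega)
    have h1 : coeff α v (iterV α v (n + 1)) * y α v ^ n ∈ P := by
      have := P.sub_mem (P.mul_mem_left (x α v) _ h) (P.mul_mem_right _ (x α v) h)
      rwa [x_mul_pow_y hv, add_sub_cancel_left] at this
    have h2 : coeff α v (aeval (u : A) p) * y α v ^ n ∈ P := by
      rw [ha, iterV_comm, map_mul, mul_assoc]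
      exact P.mul_mem_left _ _ h1
    have h3 := P.sub_mem h2 (coeff_aeval_mul_pow_sub_mem hv h p)
    rw [sub_sub_cancel] at h3
    -- Substituting `-X` is an involution, so it preserves being nonzero.
    have hp' : p.comp (-X) ≠ 0 := fun h0 => hp (by
      have := congrArg (fun q => q.comp (-X : K[X])) h0
      simpa [comp_assoc] using this)
    exact (exists_casimir_sub_mem_or_mem hv hP hp' h3).elim id ih

theorem exists_casimir_sub_mem [IsAlgClosed K] [IsDomain A]
    (hu : (u : A) ∉ Set.range (algebraMap K A)) (hsimple : IsSimpleRing (SkewLaurent α))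
    (hcenter : (Subring.center (SkewLaurent α) : Set (SkewLaurent α)) =
      Set.range fun c : K => SkewLaurent.const α (algebraMap K A c))
    (hpoly : ∀ m : ℕ, 1 ≤ m → ∃ p : Polynomial K, p ≠ 0 ∧
      ∃ a : A, Polynomial.aeval (u : A) p = iterV α (v : A) m * a)
    (hP : IsPrimeIdeal P) (hP0 : P ≠ ⊥) :
    ∃ c : K, casimir α v (u : A) - coeff α v (algebraMap K A c) ∈ P := by
  obtain ⟨p, hp, n, h⟩ := exists_evalCasimir_mul_pow_mem hv hu hsimple hcenter hP0
  exact (exists_casimir_sub_mem_or_mem hv hP hp h).elim id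
    (exists_casimir_sub_mem_of_pow_mem hv hpoly hP n)

end AmbiskewRing

end Ambiskew

/-! ### Height one primes of a domain. -/

section PrimeIdeals

variable {R : Type*} [Ring R]

theorem isPrimeIdeal_bot [IsDomain R] : IsPrimeIdeal (⊥ : TwoSidedIdeal R) := by
  refine ⟨fun h => ?_, fun a b h => ?_⟩
  · have : (1 : R) ∈ (⊥ : TwoSidedIdeal R) := h ▸ trivial
    exact one_ne_zero ((TwoSidedIdeal.mem_bot R).1 this)
  · have := h 1
    rw [mul_one, TwoSidedIdeal.mem_bot, mul_eq_zero] at this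
    exact this.imp (TwoSidedIdeal.mem_bot R).2 (TwoSidedIdeal.mem_bot R).2

theorem IsCompletelyPrimeIdeal.isPrimeIdeal {P : TwoSidedIdeal R} (h : IsCompletelyPrimeIdeal P) :
    IsPrimeIdeal P :=
  ⟨h.1, fun a b hab => h.2 a b (by simpa using hab 1)⟩

/-- In a domain the height one primes are the minimal nonzero primes. -/
theorem isHeightOnePrime_iff [IsDomain R] {P : TwoSidedIdeal R} :
    IsHeightOnePrime P ↔ IsPrimeIdeal P ∧ P ≠ ⊥ ∧ ∀ Q, IsPrimeIdeal Q → Q < P → Q = ⊥ := by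
  let b : {Q : TwoSidedIdeal R // IsPrimeIdeal Q} := ⟨⊥, isPrimeIdeal_bot⟩
  constructor
  · rintro ⟨hP, h⟩
    refine ⟨hP, ?_, fun Q hQ hlt => ?_⟩
    · rintro rfl
      have : Order.height (⟨⊥, hP⟩ : {Q : TwoSidedIdeal R // IsPrimeIdeal Q}) = 0 :=
        Order.height_eq_zero.2 fun Q _ => (bot_le : ⊥ ≤ Q.1)
      rw [this] at h
      exact zero_ne_one h
    · have hlt' := (Order.height_le_coe_iff (n := 1)).1 (le_of_eq h) ⟨Q, hQ⟩ hlt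
      have hmin := Order.height_eq_zero.1 (Order.lt_one_iff.1 hlt')
      exact le_bot_iff.1 (hmin (b := b) (bot_le : ⊥ ≤ Q))
  · rintro ⟨hP, h0, h⟩
    refine ⟨hP, le_antisymm ?_ ?_⟩
    · refine (Order.height_le_coe_iff (n := 1)).2 fun Q hQ => ?_
      have : Order.height Q = 0 := Order.height_eq_zero.2 fun Q' _ => by
        change Q.1 ≤ Q'.1
        rw [h Q.1 Q.2 hQ]
        exact bot_le
      rw [this]
      exact zero_lt_one
    · have hlt : b < ⟨P, hP⟩ := bot_lt_iff_ne_bot.2 h0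
      exact le_trans (by simp) (Order.height_add_one_le hlt)

end PrimeIdeals

/-! ### The ideals `(z - c)R` and the classification. -/

namespace AmbiskewRing

variable {K A : Type*} [Field K] [Ring A] [IsDomain A] [Algebra K A] {α : A ≃ₐ[K] A}
  {u v : Subring.center A} (hv : (v : A) = (u : A) - α (u : A))

/-- The ideal `(z - c) R` of `R = R(A, α, v, 1)`. -/
noncomputable def casimirIdeal (c : K) : TwoSidedIdeal (AmbiskewRing α v) :=
  TwoSidedIdeal.ker (toLaurent hv c)

include hv in
theorem casimir_sub_ne_zero (c : K) :
    casimir α v (u : A) - coeff α v (algebraMap K A c) ≠ 0 := by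
  intro h
  have h1 := congrArg (toLaurentPoly hv) h
  rw [map_sub, toLaurentPoly_casimir, toLaurentPoly_coeff, map_zero] at h1
  exact Polynomial.X_sub_C_ne_zero _ h1

theorem casimirIdeal_isCompletelyPrime (c : K) : IsCompletelyPrimeIdeal (casimirIdeal hv c) := by
  refine ⟨fun h => ?_, fun a b hab => ?_⟩
  · have h1 : (1 : AmbiskewRing α v) ∈ casimirIdeal hv c := h ▸ trivial
    have h2 := (TwoSidedIdeal.mem_ker _).1 h1
    rw [map_one] at h2
    exact one_ne_zero h2
  · have h := (TwoSidedIdeal.mem_ker _).1 hab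
    rw [map_mul] at h
    exact (SkewLaurent.eq_zero_or_eq_zero_of_mul_eq_zero h).imp (TwoSidedIdeal.mem_ker _).2
      (TwoSidedIdeal.mem_ker _).2

variable (hu : (u : A) ∉ Set.range (algebraMap K A))
include hu

theorem mem_casimirIdeal {c : K} {f : AmbiskewRing α v} : f ∈ casimirIdeal hv c ↔
    ∃ r, f = (casimir α v (u : A) - coeff α v (algebraMap K A c)) * r :=
  (TwoSidedIdeal.mem_ker _).trans (toLaurent_eq_zero_iff hv hu c f)

theorem casimir_sub_mem_casimirIdeal (c : K) :
    casimir α v (u : A) - coeff α v (algebraMap K A c) ∈ casimirIdeal hv c :=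
  (mem_casimirIdeal hv hu).2 ⟨1, (mul_one _).symm⟩

/-- A prime `Q` strictly inside `(z - c)R` omits `z - c`. Each `f ∈ Q` is `(z - c) r`, and primeness
forces `r ∈ Q`, so `Q` is infinitely divisible by `z - c` and vanishes. -/
theorem casimirIdeal_isHeightOnePrime (c : K) : IsHeightOnePrime (casimirIdeal hv c) := by
  have := isDomain α v
  refine isHeightOnePrime_iff.2
    ⟨(casimirIdeal_isCompletelyPrime hv c).isPrimeIdeal, fun h => ?_, fun Q hQ hlt => ?_⟩
  · have := casimir_sub_mem_casimirIdeal hv hu c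
    rw [h, TwoSidedIdeal.mem_bot] at this
    exact casimir_sub_ne_zero hv c this
  · have hz : casimir α v (u : A) - coeff α v (algebraMap K A c) ∉ Q := fun hz =>
      not_le_of_gt hlt fun f hf => by
        obtain ⟨r, rfl⟩ := (mem_casimirIdeal hv hu).1 hf
        exact Q.mul_mem_right _ _ hz
    refine le_bot_iff.1 fun f hf => (TwoSidedIdeal.mem_bot _).2 ?_
    refine eq_zero_of_forall_exists_casimir_mul (u := u) c (Q : Set _) (fun f hf => ?_) hf
    obtain ⟨r, rfl⟩ := (mem_casimirIdeal hv hu).1 (hlt.le hf)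
    exact ⟨r, (casimir_sub_mem_or_mem hv hQ hf).resolve_left hz, rfl⟩

theorem coe_casimirIdeal (c : K) : (casimirIdeal hv c : Set (AmbiskewRing α v)) =
    Set.range fun r => (casimir α v (u : A) - coeff α v (algebraMap K A c)) * r := by
  ext f
  exact (mem_casimirIdeal hv hu).trans ⟨fun ⟨r, h⟩ => ⟨r, h.symm⟩, fun ⟨r, h⟩ => ⟨r, h.symm⟩⟩

theorem casimirIdeal_isPrimeGenerator (c : K) : IsPrimeGenerator
    (casimir α v (u : A) - coeff α v (algebraMap K A c)) (casimirIdeal hv c) where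
  ne_zero := casimir_sub_ne_zero hv c
  eq_right := coe_casimirIdeal hv hu c
  eq_left := by
    rw [coe_casimirIdeal hv hu]
    exact congrArg Set.range (funext fun r => (commute_casimir_sub hv c r).eq)
  heightOne := casimirIdeal_isHeightOnePrime hv hu c
  completelyPrime := casimirIdeal_isCompletelyPrime hv c

/-- The prime `P` contains some `z - c`, hence the nonzero prime `(z - c)R`, and minimality of `P`
gives equality. -/
theorem exists_eq_casimirIdeal [IsAlgClosed K] (hsimple : IsSimpleRing (SkewLaurent α))
    (hcenter : (Subring.center (SkewLaurent α) : Set (SkewLaurent α)) =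
      Set.range fun c : K => SkewLaurent.const α (algebraMap K A c))
    (hpoly : ∀ m : ℕ, 1 ≤ m → ∃ p : Polynomial K, p ≠ 0 ∧
      ∃ a : A, Polynomial.aeval (u : A) p = iterV α (v : A) m * a)
    {P : TwoSidedIdeal (AmbiskewRing α v)} (hP : IsHeightOnePrime P) :
    ∃ c, P = casimirIdeal hv c := by
  have := isDomain α v
  obtain ⟨hP, h0, hmin⟩ := isHeightOnePrime_iff.1 hP
  obtain ⟨c, hc⟩ := exists_casimir_sub_mem hv hu hsimple hcenter hpoly hP h0
  have hle : casimirIdeal hv c ≤ P := fun f hf => by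
    obtain ⟨r, rfl⟩ := (mem_casimirIdeal hv hu).1 hf
    exact P.mul_mem_right _ _ hc
  refine ⟨c, hle.eq_or_lt.resolve_right (fun hlt => ?_) |>.symm⟩
  exact (isHeightOnePrime_iff.1 (casimirIdeal_isHeightOnePrime hv hu c)).2.1
    (hmin _ (casimirIdeal_isCompletelyPrime hv c).isPrimeIdeal hlt)

end AmbiskewRing

theorem corollary2p4 {K A : Type*} [Field K] [IsAlgClosed K] [Ring A] [IsDomain A] [Algebra K A]
    (α : A ≃ₐ[K] A) (u v : Subring.center A)
    (hv : (v : A) = (u : A) - α (u : A))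
    (huK : (u : A) ∉ Set.range (algebraMap K A))
    (hsimple : IsSimpleRing (SkewLaurent α))
    (hcenter : (Subring.center (SkewLaurent α) : Set (SkewLaurent α)) =
      Set.range fun c : K => SkewLaurent.const α (algebraMap K A c))
    (hpoly : ∀ m : ℕ, 1 ≤ m → ∃ p : Polynomial K, p ≠ 0 ∧
      ∃ a : A, Polynomial.aeval (u : A) p = iterV α (v : A) m * a) :
    (∀ I : Set (AmbiskewRing α v),
      (∃ P : TwoSidedIdeal (AmbiskewRing α v), IsHeightOnePrime P ∧ (P : Set _) = I) ↔
        ∃ c : K, I = Set.range fun r : AmbiskewRing α v =>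
          (AmbiskewRing.casimir α v (u : A) - AmbiskewRing.coeff α v (algebraMap K A c)) * r) ∧
    IsChattersUFD (AmbiskewRing α v) := by
  have hP := fun P => AmbiskewRing.exists_eq_casimirIdeal hv huK hsimple hcenter hpoly (P := P)
  refine ⟨fun I => ⟨?_, ?_⟩, AmbiskewRing.isDomain α v,
    ⟨_, AmbiskewRing.casimirIdeal_isHeightOnePrime hv huK 0⟩, fun P h => ?_⟩
  · rintro ⟨P, h, rfl⟩
    obtain ⟨c, rfl⟩ := hP P h
    exact ⟨c, AmbiskewRing.coe_casimirIdeal hv huK c⟩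
  · rintro ⟨c, rfl⟩
    exact ⟨_, AmbiskewRing.casimirIdeal_isHeightOnePrime hv huK c,
      AmbiskewRing.coe_casimirIdeal hv huK c⟩
  · obtain ⟨c, rfl⟩ := hP P h
    exact ⟨_, AmbiskewRing.casimirIdeal_isPrimeGenerator hv huK c⟩
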